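/- For $\alpha>0$ and $z\in\mathbb{H}=\{z\in\mathbb{C}:\Im z>0\}$ let $$\theta(\alpha,z)=\sum_{(m,n)\in\mathbb{Z}^2}e^{-\pi\alpha\frac{|mz+n|^2}{\Im z}},\qquad M(\alpha,z)=\sum_{(m,n)\in\mathbb{Z}^2}\frac{|mz+n|^2}{\Im z}\,e^{-\pi\alpha\frac{|mz+n|^2}{\Im z}},$$ let the subscript $yy$ denote the second partial derivative in $y$, where $z=x+iy$, and let $\Gamma_a=\{iy: y\ge 1\}$. Theorem 5.1. There is a real number $\alpha_1=0.894704\ldots$ (that is, $0.894704\le\alpha_1<0.894705$) such that the following hold. (1) $1/\alpha_1$ lies in $[1,\frac98]$ and is the unique solution $\alpha\in[1,\frac98]$ of $$\theta_{yy}(\alpha,i)=\pi\alpha M_{yy}(\alpha,i).$$ (2) Equivalently, $1/\alpha_1$ is the unique solution $\alpha\in[1,\frac98]$ of $$\frac{2}{\pi\alpha}\,\frac{\sum_{(n,m)\in\mathbb{Z}^2}\big(2m^2-\pi\alpha(n^2-m^2)^2\big)e^{-\pi\alpha(n^2+m^2)}}{\sum_{(n,m)\in\mathbb{Z}^2}\big(n^4+3m^4-\pi\alpha(n^4-m^4)(n^2-m^2)\big)e^{-\pi\alpha(n^2+m^2)}}=1,$$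 where the denominator does not vanish for $\alpha\in[1,\frac98]$. (3) If $\alpha\in[\alpha_1,1]$, then the minimum of $M(\alpha,\cdot)$ on $\Gamma_a$ is attained at $z=i$ and at no other point of $\Gamma_a$. (4) If $\alpha\in(0,\alpha_1)$, then there is a $y_\alpha>1$ such that the minimum of $M(\alpha,\cdot)$ on $\Gamma_a$ is attained at $z=iy_\alpha$ and at no other point of $\Gamma_a$. -/

import Mathlib

noncomputable section

/-- The lattice theta function, summed over the unit-density lattice
`(Im z)^(-1/2) (ℤ ⊕ z ℤ)`. It is used for `α > 0` and `z` in the upper half plane. -/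
def latticeTheta (α : ℝ) (z : ℂ) : ℝ :=
  ∑' p : ℤ × ℤ,
    Real.exp (-Real.pi * α * (‖(p.1 : ℂ) * z + (p.2 : ℂ)‖ ^ 2 / z.im))

/-- The functional `M(α, z)`: the sum of `|P|² exp(-π α |P|²)` over the points `P` of the
unit-density lattice `(Im z)^(-1/2) (ℤ ⊕ z ℤ)`. -/
def latticeM (α : ℝ) (z : ℂ) : ℝ :=
  ∑' p : ℤ × ℤ,
    ‖(p.1 : ℂ) * z + (p.2 : ℂ)‖ ^ 2 / z.im *
      Real.exp (-Real.pi * α * (‖(p.1 : ℂ) * z + (p.2 : ℂ)‖ ^ 2 / z.im))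

/-- The second partial derivative `∂²f/∂y²` at `z = x + iy` of a real function `f` of `z`. -/
def partialYY (f : ℂ → ℝ) (z : ℂ) : ℝ :=
  iteratedDeriv 2 (fun y : ℝ => f ((z.re : ℂ) + (y : ℂ) * Complex.I)) z.im

/-- The vertical half line `{z ∈ ℍ : z = iy, y ≥ 1}`. -/
def gammaA : Set ℂ := {z : ℂ | z.re = 0 ∧ 1 ≤ z.im}

/-- `z` is the minimizer of `f` on `S`: the minimum of `f` over `S` is achieved at `z ∈ S`, and at
no other point of `S`. -/
def IsTheMinimizerOn (f : ℂ → ℝ) (S : Set ℂ) (z : ℂ) : Prop :=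
  z ∈ S ∧ IsMinOn f S z ∧ ∀ w ∈ S, f w = f z → w = z

/-- The numerator series of the explicit form of the threshold equation, over `(n, m) ∈ ℤ²`. -/
def thresholdNum (a : ℝ) : ℝ :=
  ∑' p : ℤ × ℤ,
    (2 * (p.2 : ℝ) ^ 2 - Real.pi * a * ((p.1 : ℝ) ^ 2 - (p.2 : ℝ) ^ 2) ^ 2) *
      Real.exp (-Real.pi * a * ((p.1 : ℝ) ^ 2 + (p.2 : ℝ) ^ 2))

/-- The denominator series of the explicit form of the threshold equation. -/
def thresholdDen (a : ℝ) : ℝ :=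
  ∑' p : ℤ × ℤ,
    ((p.1 : ℝ) ^ 4 + 3 * (p.2 : ℝ) ^ 4 -
        Real.pi * a * ((p.1 : ℝ) ^ 4 - (p.2 : ℝ) ^ 4) * ((p.1 : ℝ) ^ 2 - (p.2 : ℝ) ^ 2)) *
      Real.exp (-Real.pi * a * ((p.1 : ℝ) ^ 2 + (p.2 : ℝ) ^ 2))

end

/-! Write S_k(X) for the sum of n^(2k) exp(-X n²) over the integers. On the imaginary axis theta and
M are built from products of these series. Since ∂θ/∂α = -πM, the combination θ - παM = ∂(αθ)/∂α is
`dualM` at (παy, πα/y), and modular inversion turns M(α, iy) into a positive multiple of this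
combination at 1/α (`latticeM_imaginary_eq_dualM`). With y = e^s and b = π/α, its derivative in s is
a positive factor times `bump (b e^s) - bump (b e^(-s))`, where bump = (X² S₂ - 2X S₁)/S₀
(`hasDerivAt_dualM`). The problem thus reduces to the shape of one function of one variable.

In the variable t = log(X/π) this function is nonpositive far to the left, rises to a single mode
and then falls, and it rises more steeply than it falls. Compare its values at τ + s and τ - s, with
τ = log(1/α) ≥ 0. If τ is not to the right of the mode, the right-hand value is always larger and
the minimum of M is at y = 1. If τ is to the right of the mode, the difference is negative up to
some s₀ > 0 and positive afterwards, so the unique minimum is at y = e^(s₀)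
(`reflection_sign_change`, `bump_sign_change`). Hence α₁ = π/m, where X = m is the mode of bump.

The asymmetry near the mode is a statement on the second logarithmic derivative `logBump₂`: it is
larger to the right of the mode than to the left. It increases on [2.5, 3.75] (`logBump₃_pos`), is
at most -6.81 on [2.5, 3.54], and is at least -6.8 on [3.75, 5.5]. Further left, on [1.9, 2.5], the
slope of bump is at least 1/2, while its descent is always slower than 1/2.

The threshold equation is the vanishing of ∂²/∂y² of θ - πaM at i, which equals 2 S₀² `bump₁` at πa
(`two_mul_thresholdNum_sub`); it says that πa is the mode. The decimals of α₁ come from the signs of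
`logBump₁` at π/0.894705 and π/0.894704. -/

open Real Set

/-! ### Gaussian moment series -/

/-- The one-sided Gaussian moment series `∑_{n ≥ 1} n^(2k) exp(-X n²)`. -/
noncomputable def gaussTail (k : ℕ) (X : ℝ) : ℝ :=
  ∑' j : ℕ, ((j : ℝ) + 1) ^ (2 * k) * exp (-X * ((j : ℝ) + 1) ^ 2)

/-- The two-sided Gaussian moment series `∑_{n ∈ ℤ} n^(2k) exp(-X n²)`. -/
noncomputable def gaussMoment (k : ℕ) (X : ℝ) : ℝ :=
  (if k = 0 then 1 else 0) + 2 * gaussTail k X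

theorem summable_gaussTail (k : ℕ) {X : ℝ} (hX : 0 < X) :
    Summable fun j : ℕ => ((j : ℝ) + 1) ^ (2 * k) * exp (-X * ((j : ℝ) + 1) ^ 2) := by
  have h := (summable_nat_add_iff 1).2 (summable_pow_mul_exp_neg_nat_mul (2 * k) hX)
  refine Summable.of_nonneg_of_le (fun j => by positivity) (fun j => ?_) h
  push_cast
  have : (0 : ℝ) ≤ j := by positivity
  refine mul_le_mul_of_nonneg_left (exp_le_exp.2 ?_) (by positivity)
  nlinarith [mul_nonneg hX.le this, mul_nonneg hX.le (mul_nonneg this this)]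

/-- Termwise differentiation on the half line to the right of X/2, where the differentiated terms
are dominated by their values at X/2. -/
theorem hasDerivAt_gaussTail (k : ℕ) {X : ℝ} (hX : 0 < X) :
    HasDerivAt (gaussTail k) (-gaussTail (k + 1) X) X := by
  have h2 : 0 < X / 2 := by positivity
  have key := hasDerivAt_tsum_of_isPreconnected (t := Set.Ioi (X / 2))
    (g := fun (j : ℕ) (Y : ℝ) => ((j : ℝ) + 1) ^ (2 * k) * exp (-Y * ((j : ℝ) + 1) ^ 2))
    (g' := fun (j : ℕ) (Y : ℝ) =>
      -(((j : ℝ) + 1) ^ (2 * (k + 1)) * exp (-Y * ((j : ℝ) + 1) ^ 2)))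
    (y₀ := X) (y := X) (summable_gaussTail (k + 1) h2) isOpen_Ioi isPreconnected_Ioi
    (fun j Y _ => ?_) (fun j Y hY => ?_) (by simp; linarith) (summable_gaussTail k hX)
    (by simp; linarith)
  · rw [tsum_neg] at key
    exact key
  · have h := (((hasDerivAt_id Y).neg.mul_const (((j : ℝ) + 1) ^ 2)).exp).const_mul
      (((j : ℝ) + 1) ^ (2 * k))
    convert! h using 1
    simp only [id, Pi.neg_apply]
    ring
  · rw [norm_neg, Real.norm_of_nonneg (by positivity)]
    have : X / 2 < Y := hY
    gcongr

theorem hasDerivAt_gaussMoment (k : ℕ) {X : ℝ} (hX : 0 < X) :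
    HasDerivAt (gaussMoment k) (-gaussMoment (k + 1) X) X := by
  have h := ((hasDerivAt_gaussTail k hX).const_mul 2).const_add (if k = 0 then (1 : ℝ) else 0)
  convert! h using 1
  simp [gaussMoment]

theorem gaussTail_pos (k : ℕ) {X : ℝ} (hX : 0 < X) : 0 < gaussTail k X :=
  (summable_gaussTail k hX).tsum_pos (fun j => by positivity) 0 (by positivity)

theorem hasSum_gaussMoment (k : ℕ) {X : ℝ} (hX : 0 < X) :
    HasSum (fun n : ℤ => (n : ℝ) ^ (2 * k) * exp (-X * (n : ℝ) ^ 2)) (gaussMoment k X) := by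
  have h : HasSum (fun j : ℕ => ((j : ℝ) + 1) ^ (2 * k) * exp (-X * ((j : ℝ) + 1) ^ 2))
      (gaussTail k X) := (summable_gaussTail k hX).hasSum
  have h' := HasSum.of_add_one_of_neg_add_one
    (f := fun n : ℤ => (n : ℝ) ^ (2 * k) * exp (-X * (n : ℝ) ^ 2))
    (m := gaussTail k X) (m' := gaussTail k X) ?_ ?_
  · convert! h' using 1
    -- The term n = 0 is 0^(2k), which is 1 for k = 0 and 0 otherwise.
    rcases Nat.eq_zero_or_pos k with rfl | hk
    · simp [gaussMoment]; ring
    · have : 2 * k ≠ 0 := by omega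
      simp [gaussMoment, hk.ne']; ring
  · simpa using h
  · convert! h using 2 with j
    push_cast
    rw [show (-((j : ℝ) + 1)) ^ (2 * k) = ((j : ℝ) + 1) ^ (2 * k) by
        rw [pow_mul, neg_sq, ← pow_mul],
      show (-((j : ℝ) + 1)) ^ 2 = ((j : ℝ) + 1) ^ 2 by ring]

theorem gaussMoment_zero (X : ℝ) : gaussMoment 0 X = 1 + 2 * gaussTail 0 X := by simp [gaussMoment]

theorem gaussMoment_succ (k : ℕ) (X : ℝ) : gaussMoment (k + 1) X = 2 * gaussTail (k + 1) X := by
  simp [gaussMoment]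

theorem gaussMoment_pos (k : ℕ) {X : ℝ} (hX : 0 < X) : 0 < gaussMoment k X := by
  have := gaussTail_pos k hX
  unfold gaussMoment
  positivity

/-- Two leading terms of `gaussTail`, with an error controlled by the third one. -/
theorem gaussTail_bounds {k : ℕ} (hk : k ≤ 5) {X : ℝ} (hX : 1.9 ≤ X) :
    exp (-X) + 4 ^ k * exp (-X) ^ 4 ≤ gaussTail k X ∧
    gaussTail k X ≤ exp (-X) + 4 ^ k * exp (-X) ^ 4 + 2 * 9 ^ k * exp (-X) ^ 9 := by
  have hX0 : 0 < X := by linarith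
  have hs := summable_gaussTail k hX0
  have hs2 := (summable_nat_add_iff 2).2 hs
  have e : gaussTail k X = exp (-X) + 4 ^ k * exp (-X) ^ 4 +
      ∑' j : ℕ, (((j + 2 : ℕ) : ℝ) + 1) ^ (2 * k) * exp (-X * (((j + 2 : ℕ) : ℝ) + 1) ^ 2) := by
    rw [gaussTail, ← hs.sum_add_tsum_nat_add 2]
    simp only [Finset.sum_range_succ, Finset.sum_range_zero]
    congr 1
    rw [← Real.exp_nat_mul, show (4 : ℝ) ^ k = 2 ^ (2 * k) by rw [pow_mul]; norm_num]
    norm_num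
    ring
  -- The index j stands for n = j + 3. From n = 3 on consecutive terms have ratio at most 1/2: the
  -- power grows by at most (16/9)^5 ≤ 18 (here k ≤ 5 enters) and the exponential shrinks by at
  -- least e^(-4) ≤ 1/36. The geometric sum gives the factor 2 in the upper bound.
  have hterm : ∀ j : ℕ, (((j + 2 : ℕ) : ℝ) + 1) ^ (2 * k) *
      exp (-X * (((j + 2 : ℕ) : ℝ) + 1) ^ 2) ≤ 9 ^ k * exp (-X) ^ 9 * (1 / 2) ^ j := by
    intro j
    induction j with
    | zero =>
      rw [← Real.exp_nat_mul, pow_mul]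
      norm_num
      rw [mul_comm]
    | succ j ih =>
      have hj : (0 : ℝ) ≤ j := by positivity
      have h1 : (((j + 1 + 2 : ℕ) : ℝ) + 1) ^ (2 * k) ≤
          18 * (((j + 2 : ℕ) : ℝ) + 1) ^ (2 * k) := by
        have ha : (((j + 1 + 2 : ℕ) : ℝ) + 1) ^ 2 ≤ (16 / 9) * (((j + 2 : ℕ) : ℝ) + 1) ^ 2 := by
          push_cast; nlinarith
        have hb : (16 / 9 : ℝ) ^ k ≤ 18 := by
          calc (16 / 9 : ℝ) ^ k ≤ (16 / 9 : ℝ) ^ 5 := by gcongr; norm_num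
            _ ≤ 18 := by norm_num
        rw [pow_mul, pow_mul]
        calc ((((j + 1 + 2 : ℕ) : ℝ) + 1) ^ 2) ^ k
            ≤ ((16 / 9) * (((j + 2 : ℕ) : ℝ) + 1) ^ 2) ^ k := by gcongr
          _ = (16 / 9) ^ k * ((((j + 2 : ℕ) : ℝ) + 1) ^ 2) ^ k := by rw [mul_pow]
          _ ≤ _ := by gcongr
      have h2 : exp (-X * (((j + 1 + 2 : ℕ) : ℝ) + 1) ^ 2) ≤
          exp (-X * (((j + 2 : ℕ) : ℝ) + 1) ^ 2) * (1 / 36) := by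
        have : (1 / 36 : ℝ) ≥ exp (-4) := by
          rw [Real.exp_neg, one_div]
          gcongr
          have := Real.exp_one_gt_d9
          calc (36 : ℝ) ≤ 2.7 ^ 4 := by norm_num
            _ ≤ exp 1 ^ 4 := by gcongr; linarith
            _ = exp 4 := by rw [← Real.exp_nat_mul]; norm_num
        calc _ ≤ exp (-X * (((j + 2 : ℕ) : ℝ) + 1) ^ 2 + -4) := by
              gcongr
              push_cast
              nlinarith
          _ = exp (-X * (((j + 2 : ℕ) : ℝ) + 1) ^ 2) * exp (-4) := Real.exp_add _ _
          _ ≤ _ := by gcongr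
      calc _ ≤ (18 * (((j + 2 : ℕ) : ℝ) + 1) ^ (2 * k)) *
            (exp (-X * (((j + 2 : ℕ) : ℝ) + 1) ^ 2) * (1 / 36)) := by gcongr
        _ = ((((j + 2 : ℕ) : ℝ) + 1) ^ (2 * k) *
            exp (-X * (((j + 2 : ℕ) : ℝ) + 1) ^ 2)) * (1 / 2) := by ring
        _ ≤ (9 ^ k * exp (-X) ^ 9 * (1 / 2) ^ j) * (1 / 2) := by gcongr
        _ = _ := by ring
  have hg : Summable fun j : ℕ => 9 ^ k * exp (-X) ^ 9 * (1 / 2 : ℝ) ^ j :=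
    summable_geometric_two.mul_left _
  constructor
  · rw [e]
    have : 0 ≤ ∑' j : ℕ, (((j + 2 : ℕ) : ℝ) + 1) ^ (2 * k) *
        exp (-X * (((j + 2 : ℕ) : ℝ) + 1) ^ 2) := tsum_nonneg fun j => by positivity
    linarith
  · rw [e]
    have h := hs2.tsum_le_tsum hterm hg
    rw [tsum_mul_left, tsum_geometric_two] at h
    linarith

/-! ### Modular transformation -/

/-- The modular transformation of the theta series. -/
theorem gaussMoment_zero_inv {X : ℝ} (hX : 0 < X) :
    gaussMoment 0 (π ^ 2 / X) = √(X / π) * gaussMoment 0 X := by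
  have h1 := (hasSum_gaussMoment 0 hX).tsum_eq
  have h2 := (hasSum_gaussMoment 0 (show 0 < π ^ 2 / X by positivity)).tsum_eq
  have h := Real.tsum_exp_neg_mul_int_sq (show 0 < X / π by positivity)
  have hpi := Real.pi_ne_zero
  simp only [mul_zero, pow_zero, one_mul] at h1 h2
  rw [show (fun n : ℤ => exp (-π * (X / π) * (n : ℝ) ^ 2)) = fun n : ℤ => exp (-X * (n : ℝ) ^ 2) by
      ext n; congr 1; field_simp,
    show (fun n : ℤ => exp (-π / (X / π) * (n : ℝ) ^ 2)) =
        fun n : ℤ => exp (-(π ^ 2 / X) * (n : ℝ) ^ 2) by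
      ext n; congr 1; field_simp, h1, h2, ← Real.sqrt_eq_rpow] at h
  have : 0 < √(X / π) := by positivity
  rw [h]; field_simp

/-! ### Theta, M and the threshold series as products of Gaussian moments -/

theorem hasSum_gaussMoment_mul (i k : ℕ) {U V : ℝ} (hU : 0 < U) (hV : 0 < V) :
    HasSum (fun p : ℤ × ℤ => (p.1 : ℝ) ^ (2 * i) * (p.2 : ℝ) ^ (2 * k) *
      exp (-U * (p.1 : ℝ) ^ 2 + -V * (p.2 : ℝ) ^ 2)) (gaussMoment i U * gaussMoment k V) := by
  have h1 := hasSum_gaussMoment i hU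
  have h2 := hasSum_gaussMoment k hV
  have hs := summable_mul_of_summable_norm h1.summable.norm h2.summable.norm
  convert! h1.mul h2 hs using 2 with p
  rw [Real.exp_add]
  ring

theorem norm_sq_div_of_imaginary {y : ℝ} (hy : 0 < y) (p : ℤ × ℤ) :
    ‖(p.1 : ℂ) * ((y : ℂ) * Complex.I) + (p.2 : ℂ)‖ ^ 2 / ((y : ℂ) * Complex.I).im =
      y * (p.1 : ℝ) ^ 2 + (p.2 : ℝ) ^ 2 / y := by
  rw [Complex.sq_norm, Complex.normSq_apply]
  simp
  field_simp
  ring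

theorem latticeTheta_imaginary {a y : ℝ} (ha : 0 < a) (hy : 0 < y) :
    latticeTheta a ((y : ℂ) * Complex.I) =
      gaussMoment 0 (π * a * y) * gaussMoment 0 (π * a / y) := by
  have h := hasSum_gaussMoment_mul 0 0 (show 0 < π * a * y by positivity)
    (show 0 < π * a / y by positivity)
  rw [latticeTheta, ← h.tsum_eq]
  refine tsum_congr fun p => ?_
  rw [norm_sq_div_of_imaginary hy]
  simp only [mul_zero, pow_zero, one_mul]
  congr 1
  field_simp
  ring

theorem latticeM_imaginary {a y : ℝ} (ha : 0 < a) (hy : 0 < y) :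
    latticeM a ((y : ℂ) * Complex.I) =
      y * (gaussMoment 1 (π * a * y) * gaussMoment 0 (π * a / y)) +
        y⁻¹ * (gaussMoment 0 (π * a * y) * gaussMoment 1 (π * a / y)) := by
  have hU : 0 < π * a * y := by positivity
  have hV : 0 < π * a / y := by positivity
  have h := ((hasSum_gaussMoment_mul 1 0 hU hV).mul_left y).add
    ((hasSum_gaussMoment_mul 0 1 hU hV).mul_left y⁻¹)
  rw [latticeM, ← h.tsum_eq]
  refine tsum_congr fun p => ?_
  rw [norm_sq_div_of_imaginary hy]
  have e : -π * a * (y * (p.1 : ℝ) ^ 2 + (p.2 : ℝ) ^ 2 / y) =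
      -(π * a * y) * (p.1 : ℝ) ^ 2 + -(π * a / y) * (p.2 : ℝ) ^ 2 := by
    field_simp
    ring
  rw [e]
  field_simp
  ring

theorem thresholdNum_eq {a : ℝ} (ha : 0 < a) :
    thresholdNum a = 2 * (gaussMoment 0 (π * a) * gaussMoment 1 (π * a)) -
      π * a * (2 * (gaussMoment 2 (π * a) * gaussMoment 0 (π * a)) -
        2 * gaussMoment 1 (π * a) ^ 2) := by
  have hb : 0 < π * a := by positivity
  have h := ((hasSum_gaussMoment_mul 0 1 hb hb).mul_left 2).sub
    ((((hasSum_gaussMoment_mul 2 0 hb hb).add (hasSum_gaussMoment_mul 0 2 hb hb)).sub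
      ((hasSum_gaussMoment_mul 1 1 hb hb).mul_left 2)).mul_left (π * a))
  rw [thresholdNum]
  trans
  · refine Eq.trans (tsum_congr fun p => ?_) h.tsum_eq
    rw [show -π * a * ((p.1 : ℝ) ^ 2 + (p.2 : ℝ) ^ 2) =
      -(π * a) * (p.1 : ℝ) ^ 2 + -(π * a) * (p.2 : ℝ) ^ 2 by ring]
    ring
  · ring

theorem thresholdDen_eq {a : ℝ} (ha : 0 < a) :
    thresholdDen a = 4 * (gaussMoment 2 (π * a) * gaussMoment 0 (π * a)) -
      π * a * (2 * (gaussMoment 3 (π * a) * gaussMoment 0 (π * a)) -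
        2 * (gaussMoment 2 (π * a) * gaussMoment 1 (π * a))) := by
  have hb : 0 < π * a := by positivity
  have h := ((hasSum_gaussMoment_mul 2 0 hb hb).add
      ((hasSum_gaussMoment_mul 0 2 hb hb).mul_left 3)).sub
    ((((hasSum_gaussMoment_mul 3 0 hb hb).add (hasSum_gaussMoment_mul 0 3 hb hb)).sub
      ((hasSum_gaussMoment_mul 2 1 hb hb).add (hasSum_gaussMoment_mul 1 2 hb hb))).mul_left
        (π * a))
  rw [thresholdDen]
  trans
  · refine Eq.trans (tsum_congr fun p => ?_) h.tsum_eq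
    rw [show -π * a * ((p.1 : ℝ) ^ 2 + (p.2 : ℝ) ^ 2) =
      -(π * a) * (p.1 : ℝ) ^ 2 + -(π * a) * (p.2 : ℝ) ^ 2 by ring]
    ring
  · ring

/-- The product formulas hold only for y > 0, which is enough because a second derivative at y = 1
depends only on values near 1. -/
theorem partialYY_I_eq {f : ℂ → ℝ} {F F' : ℝ → ℝ} {D : ℝ}
    (hf : ∀ y : ℝ, 0 < y → f ((y : ℂ) * Complex.I) = F y)
    (hF : ∀ y : ℝ, 0 < y → HasDerivAt F (F' y) y) (hF' : HasDerivAt F' D 1) :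
    partialYY f Complex.I = D := by
  have hpos : ∀ᶠ y : ℝ in nhds 1, 0 < y := eventually_gt_nhds one_pos
  have e1 : (fun y : ℝ => f ((Complex.I.re : ℂ) + (y : ℂ) * Complex.I)) =ᶠ[nhds 1] F := by
    filter_upwards [hpos] with y hy
    simpa using hf y hy
  have e2 : deriv F =ᶠ[nhds 1] F' := by
    filter_upwards [hpos] with y hy using (hF y hy).deriv
  rw [partialYY, Complex.I_im, iteratedDeriv_succ, iteratedDeriv_one,
    (e1.deriv.trans e2).deriv_eq, hF'.deriv]

theorem hasDerivAt_gaussMoment_mul_left (k : ℕ) {b y : ℝ} (hb : 0 < b) (hy : 0 < y) :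
    HasDerivAt (fun y => gaussMoment k (b * y)) (-b * gaussMoment (k + 1) (b * y)) y := by
  have h := (hasDerivAt_gaussMoment k (show 0 < b * y by positivity)).comp y
    ((hasDerivAt_id y).const_mul b)
  convert! h using 1
  ring

theorem hasDerivAt_gaussMoment_div (k : ℕ) {b y : ℝ} (hb : 0 < b) (hy : 0 < y) :
    HasDerivAt (fun y => gaussMoment k (b / y)) (b / y ^ 2 * gaussMoment (k + 1) (b / y)) y := by
  have h := (hasDerivAt_gaussMoment k (show 0 < b / y by positivity)).comp y
    ((hasDerivAt_const y b).div (hasDerivAt_id y) hy.ne')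
  convert! h using 1
  simp
  ring

theorem partialYY_latticeTheta {a : ℝ} (ha : 0 < a) :
    partialYY (latticeTheta a) Complex.I = -(π * a) * thresholdNum a := by
  have hb : 0 < π * a := by positivity
  rw [thresholdNum_eq ha]
  set b := π * a
  refine partialYY_I_eq (F := fun y => gaussMoment 0 (b * y) * gaussMoment 0 (b / y))
    (F' := fun y => -b * (gaussMoment 1 (b * y) * gaussMoment 0 (b / y)) +
      b / y ^ 2 * (gaussMoment 0 (b * y) * gaussMoment 1 (b / y)))
    (fun y hy => latticeTheta_imaginary ha hy) (fun y hy => ?_) ?_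
  · have h := (hasDerivAt_gaussMoment_mul_left 0 hb hy).mul (hasDerivAt_gaussMoment_div 0 hb hy)
    convert! h using 1
    ring
  · have h := (((hasDerivAt_gaussMoment_mul_left 1 hb one_pos).mul
      (hasDerivAt_gaussMoment_div 0 hb one_pos)).const_mul (-b)).add
      (((hasDerivAt_const (1 : ℝ) b).div (hasDerivAt_pow 2 1) (by norm_num)).mul
        ((hasDerivAt_gaussMoment_mul_left 0 hb one_pos).mul
          (hasDerivAt_gaussMoment_div 1 hb one_pos)))
    convert! h using 1
    simp
    ring

/-- Combined with `partialYY_latticeTheta`, the equation θ_yy = πa M_yy becomes 2 `thresholdNum` =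
πa `thresholdDen`, so both forms of the threshold equation are the same. -/
theorem partialYY_latticeM {a : ℝ} (ha : 0 < a) :
    partialYY (latticeM a) Complex.I = thresholdNum a - π * a * thresholdDen a := by
  have hb : 0 < π * a := by positivity
  rw [thresholdNum_eq ha, thresholdDen_eq ha]
  set b := π * a
  refine partialYY_I_eq (F := fun y => y * (gaussMoment 1 (b * y) * gaussMoment 0 (b / y)) +
      y⁻¹ * (gaussMoment 0 (b * y) * gaussMoment 1 (b / y)))
    (F' := fun y => gaussMoment 1 (b * y) * gaussMoment 0 (b / y) -
      b * (y * (gaussMoment 2 (b * y) * gaussMoment 0 (b / y))) -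
      (y ^ 2)⁻¹ * (gaussMoment 0 (b * y) * gaussMoment 1 (b / y)) +
      b * ((y ^ 3)⁻¹ * (gaussMoment 0 (b * y) * gaussMoment 2 (b / y))))
    (fun y hy => latticeM_imaginary ha hy) (fun y hy => ?_) ?_
  · have h := ((hasDerivAt_id y).mul ((hasDerivAt_gaussMoment_mul_left 1 hb hy).mul
      (hasDerivAt_gaussMoment_div 0 hb hy))).add ((hasDerivAt_inv hy.ne').mul
      ((hasDerivAt_gaussMoment_mul_left 0 hb hy).mul (hasDerivAt_gaussMoment_div 1 hb hy)))
    convert! h using 1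
    simp
    field_simp
    ring
  · have h := ((((hasDerivAt_gaussMoment_mul_left 1 hb one_pos).mul
      (hasDerivAt_gaussMoment_div 0 hb one_pos)).sub
      (((hasDerivAt_id (1 : ℝ)).mul ((hasDerivAt_gaussMoment_mul_left 2 hb one_pos).mul
        (hasDerivAt_gaussMoment_div 0 hb one_pos))).const_mul b)).sub
      (((hasDerivAt_pow 2 (1 : ℝ)).inv (by norm_num)).mul
        ((hasDerivAt_gaussMoment_mul_left 0 hb one_pos).mul
          (hasDerivAt_gaussMoment_div 1 hb one_pos)))).add
      ((((hasDerivAt_pow 3 (1 : ℝ)).inv (by norm_num)).mul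
        ((hasDerivAt_gaussMoment_mul_left 0 hb one_pos).mul
          (hasDerivAt_gaussMoment_div 2 hb one_pos))).const_mul b)
    convert! h using 1
    simp
    ring

/-! ### The dual form of M and its derivative along the imaginary axis -/

/-- The numerator `X² S₂ - 2 X S₁` of `bump`. -/
noncomputable def bumpNum (X : ℝ) : ℝ := X ^ 2 * gaussMoment 2 X - 2 * X * gaussMoment 1 X

/-- The function `X / S₀` times the second derivative of `X S₀`, whose level sets govern the critical points of
`latticeM` on the imaginary axis. -/
noncomputable def bump (X : ℝ) : ℝ := bumpNum X / gaussMoment 0 X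

/-- The combination `∂(a θ)/∂a` of theta series, as a function of the two nomes. -/
noncomputable def dualM (U V : ℝ) : ℝ :=
  gaussMoment 0 U * gaussMoment 0 V - U * (gaussMoment 1 U * gaussMoment 0 V) -
    V * (gaussMoment 0 U * gaussMoment 1 V)

theorem hasDerivAt_sqrt_div_pi {Z : ℝ} (hZ : 0 < Z) :
    HasDerivAt (fun Z => √(Z / π)) (√(Z / π) / (2 * Z)) Z := by
  have h0 : 0 < Z / π := by positivity
  have h := ((hasDerivAt_id Z).div_const π).sqrt h0.ne'
  convert! h using 1
  have h1 : √(Z / π) ^ 2 = Z / π := Real.sq_sqrt h0.le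
  have h2 : 0 < √(Z / π) := by positivity
  simp only [id]
  field_simp
  rw [h1]
  field_simp

theorem hasDerivAt_gaussMoment_inv (k : ℕ) {Z : ℝ} (hZ : 0 < Z) :
    HasDerivAt (fun Z => gaussMoment k (π ^ 2 / Z))
      (π ^ 2 / Z ^ 2 * gaussMoment (k + 1) (π ^ 2 / Z)) Z :=
  hasDerivAt_gaussMoment_div k (by positivity) hZ

/-- Differentiate the modular identity for S₀ in Z and multiply by Z. -/
theorem mul_gaussMoment_one_inv {Z : ℝ} (hZ : 0 < Z) :
    π ^ 2 / Z * gaussMoment 1 (π ^ 2 / Z) =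
      √(Z / π) * (gaussMoment 0 Z / 2 - Z * gaussMoment 1 Z) := by
  have h1 := hasDerivAt_gaussMoment_inv 0 hZ
  have h2 := (hasDerivAt_sqrt_div_pi hZ).mul (hasDerivAt_gaussMoment 0 hZ)
  have e : (fun Z => gaussMoment 0 (π ^ 2 / Z)) =ᶠ[nhds Z] fun Z => √(Z / π) * gaussMoment 0 Z := by
    filter_upwards [eventually_gt_nhds hZ] with y hy using gaussMoment_zero_inv hy
  have h := (h1.congr_of_eventuallyEq e.symm).unique h2
  simp only [zero_add] at h
  have : π ^ 2 / Z * gaussMoment 1 (π ^ 2 / Z) =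
      Z * (π ^ 2 / Z ^ 2 * gaussMoment 1 (π ^ 2 / Z)) := by
    field_simp
  rw [this, h]
  field_simp
  ring

/-- One more differentiation of the modular identity. It makes `bump` accessible for small X, where
the direct series converges slowly. -/
theorem bumpNum_inv {Z : ℝ} (hZ : 0 < Z) :
    bumpNum (π ^ 2 / Z) =
      √(Z / π) * (Z ^ 2 * gaussMoment 2 Z - Z * gaussMoment 1 Z - gaussMoment 0 Z / 4) := by
  have h1 := ((hasDerivAt_const Z (π ^ 2)).div (hasDerivAt_id Z) hZ.ne').mul
    (hasDerivAt_gaussMoment_inv 1 hZ)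
  have h2 := (hasDerivAt_sqrt_div_pi hZ).mul
    (((hasDerivAt_gaussMoment 0 hZ).div_const 2).sub
      ((hasDerivAt_id Z).mul (hasDerivAt_gaussMoment 1 hZ)))
  have e : (fun Z => π ^ 2 / Z * gaussMoment 1 (π ^ 2 / Z)) =ᶠ[nhds Z]
      fun Z => √(Z / π) * (gaussMoment 0 Z / 2 - Z * gaussMoment 1 Z) := by
    filter_upwards [eventually_gt_nhds hZ] with y hy using mul_gaussMoment_one_inv hy
  have h := (h1.congr_of_eventuallyEq e.symm).unique h2
  have h3 := mul_gaussMoment_one_inv hZ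
  simp only [zero_add, id, Pi.sub_apply, Pi.mul_apply, Pi.div_apply] at h
  norm_num at h
  have e2 : bumpNum (π ^ 2 / Z) = Z * (-π ^ 2 / Z ^ 2 * gaussMoment 1 (π ^ 2 / Z) +
      π ^ 2 / Z * (π ^ 2 / Z ^ 2 * gaussMoment 2 (π ^ 2 / Z))) -
      π ^ 2 / Z * gaussMoment 1 (π ^ 2 / Z) := by
    rw [bumpNum]
    field_simp
    ring
  rw [e2, h, h3]
  field_simp
  ring

/-- Inversion exchanges παy with (π/α)/y and πα/y with (π/α)y. Each of the two terms of M
contributes half of the S₀S₀ term of `dualM`, and the two square roots multiply to 1/α. For α ≤ 1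
the new parameter π/α is at least π. -/
theorem latticeM_imaginary_eq_dualM {α y : ℝ} (hα : 0 < α) (hy : 0 < y) :
    latticeM α ((y : ℂ) * Complex.I) = (π * α ^ 2)⁻¹ * dualM (π / α * y) (π / α / y) := by
  rw [latticeM_imaginary hα hy]
  have hU : 0 < π / α * y := by positivity
  have hV : 0 < π / α / y := by positivity
  have hpi := Real.pi_ne_zero
  have eU : π * α * y = π ^ 2 / (π / α / y) := by field_simp
  have eV : π * α / y = π ^ 2 / (π / α * y) := by field_simp
  have u0 := gaussMoment_zero_inv hU
  have v0 := gaussMoment_zero_inv hV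
  have u1 := mul_gaussMoment_one_inv hU
  have v1 := mul_gaussMoment_one_inv hV
  rw [← eU] at v0 v1
  rw [← eV] at u0 u1
  have hr : √(π / α * y / π) * √(π / α / y / π) = α⁻¹ := by
    rw [← Real.sqrt_mul (by positivity)]
    rw [show π / α * y / π * (π / α / y / π) = α⁻¹ ^ 2 by field_simp]
    exact Real.sqrt_sq (by positivity)
  have key : π * α * (y * (gaussMoment 1 (π * α * y) * gaussMoment 0 (π * α / y)) +
        y⁻¹ * (gaussMoment 0 (π * α * y) * gaussMoment 1 (π * α / y))) =
      (π * α * y * gaussMoment 1 (π * α * y)) * gaussMoment 0 (π * α / y) +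
        gaussMoment 0 (π * α * y) * (π * α / y * gaussMoment 1 (π * α / y)) := by
    ring
  have key2 : π * α * (y * (gaussMoment 1 (π * α * y) * gaussMoment 0 (π * α / y)) +
        y⁻¹ * (gaussMoment 0 (π * α * y) * gaussMoment 1 (π * α / y))) =
      α⁻¹ * dualM (π / α * y) (π / α / y) := by
    rw [key, v1, u1, u0, v0, ← hr, dualM]
    ring
  have : 0 < π * α := by positivity
  rw [show (π * α ^ 2)⁻¹ = (π * α)⁻¹ * α⁻¹ by field_simp, mul_assoc (π * α)⁻¹, ← key2,
    inv_mul_cancel_left₀ this.ne']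

theorem hasDerivAt_gaussMoment_mul_exp (k : ℕ) {b : ℝ} (hb : 0 < b) (s : ℝ) :
    HasDerivAt (fun s => gaussMoment k (b * exp s))
      (-(b * exp s) * gaussMoment (k + 1) (b * exp s)) s := by
  have h := (hasDerivAt_gaussMoment k (show 0 < b * exp s by positivity)).comp s
    ((Real.hasDerivAt_exp s).const_mul b)
  convert! h using 1
  ring

theorem hasDerivAt_gaussMoment_mul_exp_neg (k : ℕ) {b : ℝ} (hb : 0 < b) (s : ℝ) :
    HasDerivAt (fun s => gaussMoment k (b * exp (-s)))
      (b * exp (-s) * gaussMoment (k + 1) (b * exp (-s))) s := by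
  have h := (hasDerivAt_gaussMoment_mul_exp k hb (-s)).comp s (hasDerivAt_neg s)
  convert! h using 1
  ring

/-- The mixed terms UV S₁(U) S₁(V) cancel, so after division by S₀(U) S₀(V) the derivative separates
into a difference of values of one function. -/
theorem hasDerivAt_dualM {b : ℝ} (hb : 0 < b) (s : ℝ) :
    HasDerivAt (fun s => dualM (b * exp s) (b * exp (-s)))
      (gaussMoment 0 (b * exp s) * gaussMoment 0 (b * exp (-s)) *
        (bump (b * exp s) - bump (b * exp (-s)))) s := by
  have hE := (Real.hasDerivAt_exp s).const_mul b
  have hE' := ((hasDerivAt_neg s).exp).const_mul b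
  have h := (((hasDerivAt_gaussMoment_mul_exp 0 hb s).mul
      (hasDerivAt_gaussMoment_mul_exp_neg 0 hb s)).sub
    (hE.mul ((hasDerivAt_gaussMoment_mul_exp 1 hb s).mul
      (hasDerivAt_gaussMoment_mul_exp_neg 0 hb s)))).sub
    (hE'.mul ((hasDerivAt_gaussMoment_mul_exp 0 hb s).mul
      (hasDerivAt_gaussMoment_mul_exp_neg 1 hb s)))
  convert! h using 1
  have h1 := (gaussMoment_pos 0 (show 0 < b * exp s by positivity)).ne'
  have h2 := (gaussMoment_pos 0 (show 0 < b * exp (-s) by positivity)).ne'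
  rw [bump, bump, bumpNum, bumpNum]
  simp only [Pi.mul_apply]
  field_simp
  ring

/-- If `bump (b eˢ) - bump (b e⁻ˢ)` is negative for `0 < s < s₀` and positive for `s > s₀`, then
`i exp s₀` is the minimizer. -/
theorem isTheMinimizerOn_of_bump {α s₀ : ℝ} (hα : 0 < α) (hs₀ : 0 ≤ s₀)
    (hneg : ∀ s, 0 < s → s < s₀ → bump (π / α * exp s) < bump (π / α * exp (-s)))
    (hpos : ∀ s, s₀ < s → bump (π / α * exp (-s)) < bump (π / α * exp s)) :
    IsTheMinimizerOn (latticeM α) gammaA ((exp s₀ : ℝ) * Complex.I) := by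
  have hb : 0 < π / α := by positivity
  set b := π / α with hbdef
  set h : ℝ → ℝ := fun s => dualM (b * exp s) (b * exp (-s)) with hh
  have hd : ∀ s, HasDerivAt h (gaussMoment 0 (b * exp s) * gaussMoment 0 (b * exp (-s)) *
      (bump (b * exp s) - bump (b * exp (-s)))) s := hasDerivAt_dualM hb
  have hp : ∀ s, 0 < gaussMoment 0 (b * exp s) * gaussMoment 0 (b * exp (-s)) := fun s =>
    mul_pos (gaussMoment_pos 0 (by positivity)) (gaussMoment_pos 0 (by positivity))
  have hc : Continuous h := continuous_iff_continuousAt.2 fun s => (hd s).continuousAt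
  have hanti : StrictAntiOn h (Set.Icc 0 s₀) := by
    refine strictAntiOn_of_deriv_neg (convex_Icc _ _) hc.continuousOn fun s hs => ?_
    rw [interior_Icc] at hs
    rw [(hd s).deriv]
    exact mul_neg_of_pos_of_neg (hp s) (sub_neg.2 (hneg s hs.1 hs.2))
  have hmono : StrictMonoOn h (Set.Ici s₀) := by
    refine strictMonoOn_of_deriv_pos (convex_Ici _) hc.continuousOn fun s hs => ?_
    rw [interior_Ici] at hs
    rw [(hd s).deriv]
    exact mul_pos (hp s) (sub_pos.2 (hpos s hs))
  have hlt : ∀ s, 0 ≤ s → s ≠ s₀ → h s₀ < h s := by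
    intro s hs hne
    rcases lt_or_gt_of_ne hne with hlt | hgt
    · exact hanti ⟨hs, hlt.le⟩ ⟨hs₀, le_rfl⟩ hlt
    · exact hmono Set.self_mem_Ici hgt.le hgt
  have hM : ∀ s : ℝ, latticeM α ((exp s : ℝ) * Complex.I) = (π * α ^ 2)⁻¹ * h s := by
    intro s
    rw [latticeM_imaginary_eq_dualM hα (exp_pos s), hh]
    simp only [Real.exp_neg, div_eq_mul_inv, hbdef]
  have hrep : ∀ w ∈ gammaA, ∃ s, 0 ≤ s ∧ w = (exp s : ℝ) * Complex.I := by
    rintro w ⟨hre, him⟩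
    refine ⟨log w.im, Real.log_nonneg him, ?_⟩
    rw [Real.exp_log (by linarith)]
    apply Complex.ext <;> simp [hre]
  have hk : 0 < (π * α ^ 2)⁻¹ := by positivity
  refine ⟨⟨by rw [Complex.re_ofReal_mul]; simp, by
    rw [Complex.im_ofReal_mul]; simpa using hs₀⟩, ?_, ?_⟩
  · intro w hw
    obtain ⟨s, hs, rfl⟩ := hrep w hw
    change latticeM α _ ≤ latticeM α _
    rw [hM, hM]
    rcases eq_or_ne s s₀ with rfl | hne
    · exact le_rfl
    · exact (mul_lt_mul_of_pos_left (hlt s hs hne) hk).le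
  · intro w hw hwe
    obtain ⟨s, hs, rfl⟩ := hrep w hw
    rw [hM, hM] at hwe
    by_contra hne
    have hne' : s ≠ s₀ := fun h => hne (by rw [h])
    exact (mul_lt_mul_of_pos_left (hlt s hs hne') hk).ne' hwe

/-! ### Reflection of an asymmetric unimodal function -/

/-- A unimodal function `W` that rises more steeply than it falls: the sign of
`W (τ + s) - W (τ - s)` as a function of `s > 0` changes at most once, from negative to positive.
Near the mode `m` the comparison uses the convexity of `V (τ + s) - V (τ - s)` for an increasing
transform `V` of `W`; further left it uses the slopes of `W`. -/
theorem reflection_sign_change {W W₁ V V₁ V₂ : ℝ → ℝ} {e c m r : ℝ}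
    (hec : e < c) (hcm : c < m) (hmr : m < r) (hm0 : 0 ≤ m)
    (hW : ∀ t, HasDerivAt W (W₁ t) t)
    (hleft : ∀ t ≤ e, W t ≤ 0) (hpos : ∀ t, 0 ≤ t → 0 < W t)
    (hmono : StrictMonoOn W (Icc e m)) (hanti : StrictAntiOn W (Ici m))
    (hrc : W r < W c)
    (hsteep : ∀ q ∈ Icc e c, ∀ p, m ≤ p → 0 < W₁ p + W₁ q)
    (hVW : ∀ p q, c ≤ p → c ≤ q → (W p < W q ↔ V p < V q))
    (hV : ∀ t, c ≤ t → HasDerivAt V (V₁ t) t)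
    (hV₁ : ∀ t, c ≤ t → HasDerivAt V₁ (V₂ t) t)
    (hm : V₁ m = 0)
    (hV₂ : ∀ q p, c ≤ q → q ≤ m → m ≤ p → p ≤ r → q < p → V₂ q < V₂ p)
    {τ : ℝ} (hτ : 0 ≤ τ) :
    ∃ s₀, 0 ≤ s₀ ∧ (τ ≤ m → s₀ = 0) ∧ (m < τ → 0 < s₀) ∧
      (∀ s, 0 < s → s < s₀ → W (τ + s) < W (τ - s)) ∧
      ∀ s, s₀ < s → W (τ - s) < W (τ + s) := by
  have hEderiv : ∀ τ s, c ≤ τ - s → c ≤ τ + s →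
      HasDerivAt (fun s => V (τ + s) - V (τ - s)) (V₁ (τ + s) + V₁ (τ - s)) s := by
    intro τ s h1 h2
    have h := ((hV _ h2).comp s ((hasDerivAt_id s).const_add τ)).sub
      ((hV _ h1).comp s ((hasDerivAt_id s).const_sub τ))
    convert! h using 1
    ring
  have hEderiv₂ : ∀ τ s, c ≤ τ - s → c ≤ τ + s →
      HasDerivAt (fun s => V₁ (τ + s) + V₁ (τ - s)) (V₂ (τ + s) - V₂ (τ - s)) s := by
    intro τ s h1 h2
    have h := ((hV₁ _ h2).comp s ((hasDerivAt_id s).const_add τ)).add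
      ((hV₁ _ h1).comp s ((hasDerivAt_id s).const_sub τ))
    convert! h using 1
    ring
  have hDderiv : ∀ τ s, HasDerivAt (fun s => W (τ + s) - W (τ - s)) (W₁ (τ + s) + W₁ (τ - s)) s := by
    intro τ s
    have h := ((hW _).comp s ((hasDerivAt_id s).const_add τ)).sub
      ((hW _).comp s ((hasDerivAt_id s).const_sub τ))
    convert! h using 1
    simp only [id]
    ring
  -- On this range of s the left point lies in [c, m] and the right point in [m, r], exactly where
  -- `hV₂` compares V₂.
  have hE'mono : ∀ τ, m ≤ τ → ∀ K, K ≤ τ - c → K ≤ r - τ →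
      StrictMonoOn (fun s => V₁ (τ + s) + V₁ (τ - s)) (Icc (τ - m) K) := by
    intro τ hτm K hK1 hK2
    refine strictMonoOn_of_deriv_pos (convex_Icc _ _) (fun s hs => ?_) fun s hs => ?_
    · have h1 := hs.1
      have h2 := hs.2
      exact (hEderiv₂ τ s (by linarith) (by linarith)).continuousAt.continuousWithinAt
    · rw [interior_Icc] at hs
      have h1 := hs.1
      have h2 := hs.2
      rw [(hEderiv₂ τ s (by linarith) (by linarith)).deriv]
      have := hV₂ (τ - s) (τ + s) (by linarith) (by linarith) (by linarith) (by linarith)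
        (by linarith)
      linarith
  -- The difference of V is strictly convex and is at most 0 at s = τ - m, where the left point is
  -- the mode. Once it is nonnegative, it is therefore positive afterwards.
  have hconv : ∀ τ, m ≤ τ → ∀ s s', τ - m < s → s < s' → s' ≤ τ - c → s' ≤ r - τ →
      W (τ - s) ≤ W (τ + s) → W (τ - s') < W (τ + s') := by
    intro τ hτm s s' hs hss' h1 h2 hge
    have hcv : StrictConvexOn ℝ (Icc (τ - m) s') fun s => V (τ + s) - V (τ - s) := by
      refine StrictMonoOn.strictConvexOn_of_deriv (convex_Icc _ _) (fun s hs => ?_) ?_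
      · have h1 := hs.1
        have h2 := hs.2
        exact (hEderiv τ s (by linarith) (by linarith)).continuousAt.continuousWithinAt
      · have hmo := (hE'mono τ hτm s' h1 h2).mono interior_subset
        intro x hx y hy hxy
        have hx' := interior_subset hx
        have hy' := interior_subset hy
        rw [(hEderiv τ x (by linarith [hx'.2]) (by linarith [hx'.1])).deriv,
          (hEderiv τ y (by linarith [hy'.2]) (by linarith [hy'.1])).deriv]
        exact hmo hx hy hxy
    have hsl := hcv.slope_strict_mono_adjacent (left_mem_Icc.2 (by linarith))
      (right_mem_Icc.2 (by linarith)) hs hss'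
    have hstart : V (τ + (τ - m)) - V (τ - (τ - m)) ≤ 0 := by
      have : ¬ W m < W (τ + (τ - m)) := not_lt.2 <|
        hanti.antitoneOn self_mem_Ici (by rw [mem_Ici]; linarith) (by linarith)
      rw [hVW _ _ hcm.le (by linarith)] at this
      rw [show τ - (τ - m) = m by ring]
      linarith
    have hmid : 0 ≤ V (τ + s) - V (τ - s) := by
      have := hge.not_gt
      rw [hVW _ _ (by linarith) (by linarith)] at this
      linarith
    have hl : 0 ≤ (V (τ + s) - V (τ - s) - (V (τ + (τ - m)) - V (τ - (τ - m)))) / (s - (τ - m)) :=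
      div_nonneg (by linarith) (by linarith)
    have hr := (hl.trans_lt hsl)
    rw [div_pos_iff_of_pos_right (by linarith)] at hr
    rw [hVW _ _ (by linarith) (by linarith)]
    linarith
  -- The right point is beyond r while the left one is still in [c, m], so `hrc` and monotonicity
  -- decide.
  have hfar : ∀ τ, m ≤ τ → ∀ s, τ - m ≤ s → s ≤ τ - c → r - τ ≤ s →
      W (τ + s) < W (τ - s) := by
    intro τ hτm s h1 h2 h3
    have ha : W (τ + s) ≤ W r := hanti.antitoneOn hmr.le (by rw [mem_Ici]; linarith) (by linarith)
    have hb : W c ≤ W (τ - s) := hmono.monotoneOn ⟨hec.le, hcm.le⟩ ⟨by linarith, by linarith⟩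
      (by linarith)
    linarith
  have hnear : ∀ τ, ∀ s, 0 < s → s ≤ τ - m → W (τ + s) < W (τ - s) := fun τ s h1 h2 =>
    hanti (by rw [mem_Ici]; linarith) (by rw [mem_Ici]; linarith) (by linarith)
  have hend : ∀ τ, 0 ≤ τ → ∀ s, 0 < s → τ - e ≤ s → W (τ - s) < W (τ + s) := fun τ hτ s hs h =>
    (hleft _ (by linarith)).trans_lt (hpos _ (by linarith))
  -- With the left point in [e, c] the slope condition makes the difference of W itself increasing
  -- in s.
  have hslope : ∀ τ, m ≤ τ → ∀ s s', τ - c ≤ s → s < s' → s' ≤ τ - e →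
      W (τ - s) ≤ W (τ + s) → W (τ - s') < W (τ + s') := by
    intro τ hτm s s' h1 h2 h3 hge
    have hmo : StrictMonoOn (fun s => W (τ + s) - W (τ - s)) (Icc (τ - c) (τ - e)) := by
      refine strictMonoOn_of_deriv_pos (convex_Icc _ _)
        (fun s _ => (hDderiv τ s).continuousAt.continuousWithinAt) fun s hs => ?_
      rw [interior_Icc] at hs
      rw [(hDderiv τ s).deriv]
      exact hsteep _ ⟨by linarith [hs.2], by linarith [hs.1]⟩ _ (by linarith [hs.1])
    have := hmo ⟨h1, by linarith⟩ ⟨by linarith, h3⟩ h2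
    simp only at this
    linarith
  have hfwd : ∀ τ, m ≤ τ → ∀ s s', 0 < s → s < s' → W (τ - s) ≤ W (τ + s) →
      W (τ - s') < W (τ + s') := by
    intro τ hτm s s' hs hss' hge
    have h1 : τ - m < s := by
      by_contra! h
      exact (hnear τ s hs h).not_ge hge
    rcases le_total (τ - e) s' with h2 | h2
    · exact hend τ (by linarith) s' (by linarith) h2
    rcases le_total (τ - c) s with h3 | h3
    · exact hslope τ hτm s s' h3 hss' h2 hge
    have h4 : s < r - τ := by
      by_contra! h
      exact (hfar τ hτm s h1.le h3 h).not_ge hge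
    -- The right point cannot reach r before the left one has reached c: convexity would make the
    -- difference positive at s = r - τ, where `hfar` makes it negative.
    have hlim : ∀ u, s < u → u ≤ τ - c → u < r - τ := by
      intro u hu huc
      by_contra! h
      exact (hconv τ hτm s (r - τ) h1 h4 (by linarith) le_rfl hge).not_gt
        (hfar τ hτm _ (by linarith) (by linarith) le_rfl)
    rcases le_total s' (τ - c) with h5 | h5
    · exact hconv τ hτm s s' h1 hss' h5 (hlim s' hss' h5).le hge
    rcases h3.eq_or_lt with h6 | h6
    · exact hslope τ hτm s s' h6.ge hss' h2 hge
    have h7 := hconv τ hτm s (τ - c) h1 h6 le_rfl (hlim _ h6 le_rfl).le hge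
    rcases h5.eq_or_lt with h8 | h8
    · rwa [← h8]
    · exact hslope τ hτm (τ - c) s' le_rfl h8 h2 h7.le
  -- For τ = m the difference of V and its derivative 2 V₁(m) both vanish at s = 0, and the
  -- derivative increases, so the difference is positive at once; `hfwd` then carries this to all s.
  have hmode : ∀ s, 0 < s → W (m - s) < W (m + s) := by
    have hK : 0 < min (m - c) (r - m) := lt_min (by linarith) (by linarith)
    have hsmall : ∀ s, 0 < s → s ≤ min (m - c) (r - m) → W (m - s) < W (m + s) := by
      intro s hs hsK
      have h1 := hsK.trans (min_le_left _ _)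
      have h2 := hsK.trans (min_le_right _ _)
      have hmo := hE'mono m le_rfl s h1 h2
      rw [sub_self] at hmo
      have hEm : StrictMonoOn (fun s => V (m + s) - V (m - s)) (Icc 0 s) := by
        refine strictMonoOn_of_deriv_pos (convex_Icc _ _) (fun u hu => ?_) fun u hu => ?_
        · exact (hEderiv m u (by linarith [hu.2]) (by linarith [hu.1])).continuousAt.continuousWithinAt
        · rw [interior_Icc] at hu
          rw [(hEderiv m u (by linarith [hu.2]) (by linarith [hu.1])).deriv]
          have := hmo (left_mem_Icc.2 hs.le) ⟨hu.1.le, hu.2.le⟩ hu.1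
          simpa [hm] using this
      have := hEm (left_mem_Icc.2 hs.le) (right_mem_Icc.2 hs.le) hs
      rw [hVW _ _ (by linarith) (by linarith)]
      simp at this
      linarith
    intro s hs
    rcases le_or_gt s (min (m - c) (r - m)) with h | h
    · exact hsmall s hs h
    · exact hfwd m le_rfl _ s hK h (hsmall _ hK le_rfl).le
  rcases le_or_gt τ m with hτm | hτm
  · refine ⟨0, le_rfl, fun _ => rfl, fun h => absurd h hτm.not_gt, fun s h h' => absurd h h'.not_gt,
      fun s hs => ?_⟩
    rcases le_total (τ - e) s with h1 | h1
    · exact hend τ hτ s hs h1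
    rcases le_total (τ + s) m with h2 | h2
    · exact hmono ⟨by linarith, by linarith⟩ ⟨by linarith, h2⟩ (by linarith)
    -- The reflection of τ - s in m lies at or to the right of τ + s, since τ ≤ m, and W decreases
    -- there.
    · have h3 := hmode (m - (τ - s)) (by linarith)
      rw [sub_sub_cancel] at h3
      refine h3.trans_le (hanti.antitoneOn h2 ?_ ?_)
      · rw [mem_Ici]; linarith
      · linarith
  -- By `hfwd` the set A is upward closed, with strict inequality beyond any of its points, so its
  -- infimum is the sign change and no continuity argument is needed.
  · set A : Set ℝ := {s | 0 < s ∧ W (τ - s) ≤ W (τ + s)} with hA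
    have hAbdd : ∀ s ∈ A, τ - m ≤ s := by
      intro s hs
      by_contra! h
      exact (hnear τ s hs.1 h.le).not_ge hs.2
    have hAne : A.Nonempty :=
      ⟨τ - e, by linarith, (hend τ hτ _ (by linarith) le_rfl).le⟩
    have hBB : BddBelow A := ⟨τ - m, hAbdd⟩
    have hs₀ : τ - m ≤ sInf A := le_csInf hAne hAbdd
    refine ⟨sInf A, by linarith, fun h => absurd h hτm.not_ge, fun _ => by linarith,
      fun s hs hlt => ?_, fun s hs => ?_⟩
    · by_contra! h
      exact (csInf_le hBB ⟨hs, h⟩).not_gt hlt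
    · obtain ⟨u, hu, hus⟩ := exists_lt_of_csInf_lt hAne hs
      exact hfwd τ hτm.le u s hu.1 hus hu.2

/-! ### Logarithmic derivatives of bump -/

/-- `gaussTail` normalised by its leading term `exp (-X)`. -/
noncomputable def gaussRel (k : ℕ) (X : ℝ) : ℝ := exp X * gaussTail k X

theorem gaussTail_eq_gaussRel (k : ℕ) (X : ℝ) : gaussTail k X = exp (-X) * gaussRel k X := by
  rw [gaussRel, ← mul_assoc, ← Real.exp_add]
  simp

theorem gaussRel_pos (k : ℕ) {X : ℝ} (hX : 0 < X) : 0 < gaussRel k X :=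
  mul_pos (exp_pos X) (gaussTail_pos k hX)

theorem hasDerivAt_gaussRel (k : ℕ) {X : ℝ} (hX : 0 < X) :
    HasDerivAt (gaussRel k) (gaussRel k X - gaussRel (k + 1) X) X := by
  have h := (Real.hasDerivAt_exp X).mul (hasDerivAt_gaussTail k hX)
  convert! h using 1
  simp only [gaussRel]
  ring

theorem gaussRel_bounds {k : ℕ} (hk : k ≤ 5) {X : ℝ} (hX : 1.9 ≤ X) :
    1 + 4 ^ k * exp (-X) ^ 3 ≤ gaussRel k X ∧
    gaussRel k X ≤ 1 + 4 ^ k * exp (-X) ^ 3 + 2 * 9 ^ k * exp (-X) ^ 8 := by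
  obtain ⟨h1, h2⟩ := gaussTail_bounds hk hX
  rw [gaussTail_eq_gaussRel] at h1 h2
  have hE := exp_pos (-X)
  constructor
  · refine le_of_mul_le_mul_left ?_ hE
    linarith
  · refine le_of_mul_le_mul_left ?_ hE
    linarith

/-- `gaussRel` to first order in `exp (-3X)`, with a relative bound for the remainder. -/
theorem gaussRel_eq {k : ℕ} (hk : k ≤ 5) {X : ℝ} (hX : 1.9 ≤ X) {c : ℝ}
    (hc : exp (-X) ^ 5 ≤ c) :
    ∃ d, 0 ≤ d ∧ d ≤ 2 * 9 ^ k * c * exp (-X) ^ 3 ∧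
      gaussRel k X = 1 + 4 ^ k * exp (-X) ^ 3 + d := by
  obtain ⟨h1, h2⟩ := gaussRel_bounds hk hX
  refine ⟨gaussRel k X - (1 + 4 ^ k * exp (-X) ^ 3), by linarith, ?_, by ring⟩
  have : 2 * 9 ^ k * exp (-X) ^ 3 * exp (-X) ^ 5 ≤ 2 * 9 ^ k * exp (-X) ^ 3 * c := by gcongr
  calc _ ≤ 2 * 9 ^ k * exp (-X) ^ 8 := by linarith
    _ = 2 * 9 ^ k * exp (-X) ^ 3 * exp (-X) ^ 5 := by ring
    _ ≤ _ := by linarith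

theorem gaussTail_le_succ (k : ℕ) {X : ℝ} (hX : 0 < X) : gaussTail k X ≤ gaussTail (k + 1) X := by
  refine (summable_gaussTail k hX).tsum_le_tsum (fun j => ?_) (summable_gaussTail (k + 1) hX)
  have : (1 : ℝ) ≤ (j : ℝ) + 1 := by linarith [(Nat.cast_nonneg j : (0 : ℝ) ≤ j)]
  exact mul_le_mul_of_nonneg_right (pow_le_pow_right₀ this (by omega)) (by positivity)

/-- The factor `X U₂ - 2 U₁` in `bumpNum X = 2 X exp (-X) (X U₂ - 2 U₁)`. -/
noncomputable def bumpCore (X : ℝ) : ℝ := X * gaussRel 2 X - 2 * gaussRel 1 X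

/-- The derivative of `bumpCore`. -/
noncomputable def bumpCore₁ (X : ℝ) : ℝ :=
  X * (gaussRel 2 X - gaussRel 3 X) + 3 * gaussRel 2 X - 2 * gaussRel 1 X

/-- The second derivative of `bumpCore`. -/
noncomputable def bumpCore₂ (X : ℝ) : ℝ :=
  X * (gaussRel 2 X - 2 * gaussRel 3 X + gaussRel 4 X) + 6 * gaussRel 2 X - 4 * gaussRel 3 X -
    2 * gaussRel 1 X

/-- The third derivative of `bumpCore`. -/
noncomputable def bumpCore₃ (X : ℝ) : ℝ :=
  X * (gaussRel 2 X - 3 * gaussRel 3 X + 3 * gaussRel 4 X - gaussRel 5 X) + 9 * gaussRel 2 X -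
    12 * gaussRel 3 X + 5 * gaussRel 4 X - 2 * gaussRel 1 X

theorem hasDerivAt_bumpCore {X : ℝ} (hX : 0 < X) : HasDerivAt bumpCore (bumpCore₁ X) X := by
  have h := ((hasDerivAt_id X).mul (hasDerivAt_gaussRel 2 hX)).sub
    ((hasDerivAt_gaussRel 1 hX).const_mul 2)
  convert! h using 1
  simp only [bumpCore₁, id]
  ring

theorem hasDerivAt_bumpCore₁ {X : ℝ} (hX : 0 < X) : HasDerivAt bumpCore₁ (bumpCore₂ X) X := by
  have h := (((hasDerivAt_id X).mul ((hasDerivAt_gaussRel 2 hX).sub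
    (hasDerivAt_gaussRel 3 hX))).add ((hasDerivAt_gaussRel 2 hX).const_mul 3)).sub
    ((hasDerivAt_gaussRel 1 hX).const_mul 2)
  convert! h using 1
  simp only [bumpCore₂, id, Pi.sub_apply]
  ring

theorem hasDerivAt_bumpCore₂ {X : ℝ} (hX : 0 < X) : HasDerivAt bumpCore₂ (bumpCore₃ X) X := by
  have h := ((((hasDerivAt_id X).mul (((hasDerivAt_gaussRel 2 hX).sub
    ((hasDerivAt_gaussRel 3 hX).const_mul 2)).add (hasDerivAt_gaussRel 4 hX))).add
    ((hasDerivAt_gaussRel 2 hX).const_mul 6)).sub ((hasDerivAt_gaussRel 3 hX).const_mul 4)).sub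
    ((hasDerivAt_gaussRel 1 hX).const_mul 2)
  convert! h using 1
  simp only [bumpCore₃, id, Pi.sub_apply, Pi.add_apply]
  ring

theorem bumpNum_eq_bumpCore (X : ℝ) : bumpNum X = 2 * X * exp (-X) * bumpCore X := by
  rw [bumpNum, gaussMoment_succ, gaussMoment_succ, gaussTail_eq_gaussRel, gaussTail_eq_gaussRel,
    bumpCore]
  ring

/-- With ε = exp(-3X), the core is X - 2 + ε(16X - 8) up to order exp(-8X). The second term keeps it
positive at X = 2 itself. -/
theorem bumpCore_pos {X : ℝ} (hX : 2 ≤ X) : 0 < bumpCore X := by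
  obtain ⟨h1, -⟩ := gaussRel_bounds (k := 2) (by norm_num) (show 1.9 ≤ X by norm_num; linarith)
  obtain ⟨-, h2⟩ := gaussRel_bounds (k := 1) (by norm_num) (show 1.9 ≤ X by norm_num; linarith)
  have hE := exp_pos (-X)
  have hE1 : exp (-X) ≤ 1 / 2 := by
    rw [Real.exp_neg, one_div]
    gcongr
    linarith [Real.add_one_le_exp X]
  have h5 : exp (-X) ^ 5 ≤ (1 / 2) ^ 5 := by gcongr
  have h3 : 0 < exp (-X) ^ 3 := by positivity
  have h8 : exp (-X) ^ 8 ≤ exp (-X) ^ 3 * (1 / 2) ^ 5 := by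
    calc _ = exp (-X) ^ 3 * exp (-X) ^ 5 := by ring
      _ ≤ _ := by gcongr
  have h0 : 0 < gaussRel 2 X := gaussRel_pos 2 (by linarith)
  rw [bumpCore]
  nlinarith

theorem bump_pos {X : ℝ} (hX : 2 ≤ X) : 0 < bump X := by
  have := bumpCore_pos hX
  have h0 := gaussMoment_pos 0 (show 0 < X by linarith)
  rw [bump, bumpNum_eq_bumpCore]
  positivity

/-- The logarithmic derivative `X (log bump)'`. -/
noncomputable def logBump₁ (X : ℝ) : ℝ :=
  1 - X + X * (bumpCore₁ X / bumpCore X) + X * (gaussMoment 1 X / gaussMoment 0 X)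

/-- The second logarithmic derivative `(X d/dX)² log bump`. -/
noncomputable def logBump₂ (X : ℝ) : ℝ :=
  -X + X * (bumpCore₁ X / bumpCore X) +
    X ^ 2 * (bumpCore₂ X / bumpCore X - (bumpCore₁ X / bumpCore X) ^ 2) +
    X * (gaussMoment 1 X / gaussMoment 0 X) -
    X ^ 2 * (gaussMoment 2 X / gaussMoment 0 X - (gaussMoment 1 X / gaussMoment 0 X) ^ 2)

/-- The third logarithmic derivative `(X d/dX)³ log bump`. -/
noncomputable def logBump₃ (X : ℝ) : ℝ :=
  -X + X * (bumpCore₁ X / bumpCore X) +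
    3 * X ^ 2 * (bumpCore₂ X / bumpCore X - (bumpCore₁ X / bumpCore X) ^ 2) +
    X ^ 3 * (bumpCore₃ X / bumpCore X -
      3 * (bumpCore₁ X / bumpCore X) * (bumpCore₂ X / bumpCore X) +
      2 * (bumpCore₁ X / bumpCore X) ^ 3) +
    X * (gaussMoment 1 X / gaussMoment 0 X) -
    3 * X ^ 2 * (gaussMoment 2 X / gaussMoment 0 X - (gaussMoment 1 X / gaussMoment 0 X) ^ 2) +
    X ^ 3 * (gaussMoment 3 X / gaussMoment 0 X -
      3 * (gaussMoment 1 X / gaussMoment 0 X) * (gaussMoment 2 X / gaussMoment 0 X) +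
      2 * (gaussMoment 1 X / gaussMoment 0 X) ^ 3)

/-- The logarithmic-scale derivative of `bump`, that is `X` times its derivative. -/
noncomputable def bump₁ (X : ℝ) : ℝ :=
  ((-X ^ 3 * gaussMoment 3 X + 4 * X ^ 2 * gaussMoment 2 X - 2 * X * gaussMoment 1 X) *
    gaussMoment 0 X + bumpNum X * (X * gaussMoment 1 X)) / gaussMoment 0 X ^ 2

theorem hasDerivAt_bump {X : ℝ} (hX : 0 < X) : HasDerivAt bump (bump₁ X / X) X := by
  have h0 := (gaussMoment_pos 0 hX).ne'
  have hN := ((hasDerivAt_pow 2 X).mul (hasDerivAt_gaussMoment 2 hX)).sub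
    (((hasDerivAt_id X).const_mul 2).mul (hasDerivAt_gaussMoment 1 hX))
  have h := hN.div (hasDerivAt_gaussMoment 0 hX) h0
  convert! h using 1
  simp only [bump₁, bumpNum, id, Pi.sub_apply, Pi.mul_apply]
  field_simp
  push_cast
  ring

theorem bump₁_eq {X : ℝ} (hX : 2 ≤ X) : bump₁ X = bump X * logBump₁ X := by
  have h0 := (gaussMoment_pos 0 (show 0 < X by linarith)).ne'
  have h1 := (bumpCore_pos hX).ne'
  rw [bump₁, bump, bumpNum_eq_bumpCore, logBump₁]
  field_simp
  simp only [gaussMoment_succ, gaussTail_eq_gaussRel, bumpCore, bumpCore₁]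
  ring

theorem hasDerivAt_log_bump {X : ℝ} (hX : 2 ≤ X) :
    HasDerivAt (fun X => log (bump X)) (logBump₁ X / X) X := by
  have h := (hasDerivAt_bump (show 0 < X by linarith)).log (bump_pos hX).ne'
  convert! h using 1
  rw [bump₁_eq hX]
  have := (bump_pos hX).ne'
  field_simp

theorem hasDerivAt_bumpCore₁_div {X : ℝ} (hX : 2 ≤ X) :
    HasDerivAt (fun X => bumpCore₁ X / bumpCore X)
      (bumpCore₂ X / bumpCore X - (bumpCore₁ X / bumpCore X) ^ 2) X := by
  have h0 : 0 < X := by linarith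
  have h1 := (bumpCore_pos hX).ne'
  have h := (hasDerivAt_bumpCore₁ h0).div (hasDerivAt_bumpCore h0) h1
  convert! h using 1
  field_simp

theorem hasDerivAt_bumpCore₂_div {X : ℝ} (hX : 2 ≤ X) :
    HasDerivAt (fun X => bumpCore₂ X / bumpCore X)
      (bumpCore₃ X / bumpCore X - (bumpCore₁ X / bumpCore X) * (bumpCore₂ X / bumpCore X)) X := by
  have h0 : 0 < X := by linarith
  have h1 := (bumpCore_pos hX).ne'
  have h := (hasDerivAt_bumpCore₂ h0).div (hasDerivAt_bumpCore h0) h1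
  convert! h using 1
  field_simp

theorem hasDerivAt_gaussMoment_div_zero (k : ℕ) {X : ℝ} (hX : 0 < X) :
    HasDerivAt (fun X => gaussMoment k X / gaussMoment 0 X)
      (-(gaussMoment (k + 1) X / gaussMoment 0 X) +
        (gaussMoment 1 X / gaussMoment 0 X) * (gaussMoment k X / gaussMoment 0 X)) X := by
  have h1 := (gaussMoment_pos 0 hX).ne'
  have h := (hasDerivAt_gaussMoment k hX).div (hasDerivAt_gaussMoment 0 hX) h1
  convert! h using 1
  field_simp
  ring

theorem hasDerivAt_logBump₁ {X : ℝ} (hX : 2 ≤ X) :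
    HasDerivAt logBump₁ (logBump₂ X / X) X := by
  have h0 : 0 < X := by linarith
  have h := (((hasDerivAt_id X).const_sub 1).add
    ((hasDerivAt_id X).mul (hasDerivAt_bumpCore₁_div hX))).add
    ((hasDerivAt_id X).mul (hasDerivAt_gaussMoment_div_zero 1 h0))
  convert! h using 1
  simp only [logBump₂, id]
  rw [div_eq_iff h0.ne']
  ring

theorem hasDerivAt_logBump₂ {X : ℝ} (hX : 2 ≤ X) :
    HasDerivAt logBump₂ (logBump₃ X / X) X := by
  have h0 : 0 < X := by linarith
  have hr := hasDerivAt_bumpCore₁_div hX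
  have hs := hasDerivAt_gaussMoment_div_zero 1 h0
  have h := ((((hasDerivAt_id X).neg.add ((hasDerivAt_id X).mul hr)).add
    ((hasDerivAt_pow 2 X).mul ((hasDerivAt_bumpCore₂_div hX).sub (hr.pow 2)))).add
    ((hasDerivAt_id X).mul hs)).sub
    ((hasDerivAt_pow 2 X).mul ((hasDerivAt_gaussMoment_div_zero 2 h0).sub (hs.pow 2)))
  convert! h using 1
  simp only [logBump₃, id, Pi.sub_apply, Pi.pow_apply]
  rw [div_eq_iff h0.ne']
  push_cast
  ring

theorem hasDerivAt_comp_pi_mul_exp {f : ℝ → ℝ} {D t : ℝ}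
    (h : HasDerivAt f (D / (π * exp t)) (π * exp t)) :
    HasDerivAt (fun t => f (π * exp t)) D t := by
  have h' := h.comp t ((Real.hasDerivAt_exp t).const_mul π)
  have : π * exp t ≠ 0 := by positivity
  convert! h' using 1
  field_simp

/-! ### Numerical bounds for exponentials and for the core -/

/-- Reduces a bound at a rational point p/q to rational arithmetic: a e^(p/q) ≥ 1 is raised to the
power q and e is replaced by a decimal lower bound. -/
theorem exp_neg_div_le {p q : ℕ} (hq : q ≠ 0) {a X : ℝ} (ha : 0 ≤ a)
    (h : 1 ≤ a ^ q * 2.7182818283 ^ p) (hX : (p : ℝ) / q ≤ X) : exp (-X) ≤ a := by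
  have hE := exp_pos ((p : ℝ) / q)
  have hq' : (q : ℝ) ≠ 0 := by exact_mod_cast hq
  have h1 : exp ((p : ℝ) / q) ^ q = exp 1 ^ p := by
    rw [← Real.exp_nat_mul, ← Real.exp_nat_mul]
    congr 1
    field_simp
  have h2 : (1 : ℝ) ^ q ≤ (a * exp ((p : ℝ) / q)) ^ q := by
    rw [one_pow, mul_pow, h1]
    refine h.trans ?_
    have := Real.exp_one_gt_d9
    gcongr
  have h3 := le_of_pow_le_pow_left₀ hq (by positivity) h2
  calc exp (-X) ≤ exp (-((p : ℝ) / q)) := exp_le_exp.2 (by linarith)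
    _ = 1 / exp ((p : ℝ) / q) := by rw [Real.exp_neg, one_div]
    _ ≤ a := by rwa [div_le_iff₀ hE]

theorem le_exp_neg_div {p q : ℕ} (hq : q ≠ 0) {a X : ℝ}
    (h : a ^ q * 2.7182818286 ^ p ≤ 1) (ha : 0 ≤ a) (hX : X ≤ (p : ℝ) / q) : a ≤ exp (-X) := by
  have hE := exp_pos ((p : ℝ) / q)
  have hq' : (q : ℝ) ≠ 0 := by exact_mod_cast hq
  have h1 : exp ((p : ℝ) / q) ^ q = exp 1 ^ p := by
    rw [← Real.exp_nat_mul, ← Real.exp_nat_mul]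
    congr 1
    field_simp
  have h2 : (a * exp ((p : ℝ) / q)) ^ q ≤ (1 : ℝ) ^ q := by
    rw [one_pow, mul_pow, h1]
    refine le_trans ?_ h
    have := Real.exp_one_lt_d9
    gcongr
  have h3 := le_of_pow_le_pow_left₀ hq (by positivity) h2
  calc a ≤ 1 / exp ((p : ℝ) / q) := by rwa [le_div_iff₀ hE]
    _ = exp (-((p : ℝ) / q)) := by rw [Real.exp_neg, one_div]
    _ ≤ exp (-X) := exp_le_exp.2 (by linarith)

theorem exp_neg_pow_five_le {X : ℝ} (hX : 2.5 ≤ X) : exp (-X) ^ 5 ≤ 0.000004 := by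
  have h : exp (-X) ≤ 0.0821 :=
    exp_neg_div_le (p := 5) (q := 2) (by norm_num) (by norm_num) (by norm_num)
      (by norm_num at hX ⊢; linarith)
  calc exp (-X) ^ 5 ≤ 0.0821 ^ 5 := by gcongr
    _ ≤ 0.000004 := by norm_num

/-- To first order in ε = exp(-3X), the core is X - 2 + ε(16X - 8) and its derivatives are 1 - ε(48X
- 40), ε(144X - 168) and -ε(432X - 648). Where this and the following bounds keep the ε term, their
constants are these with room for the remainders d_k; X ≤ 5.5 serves to absorb products X d_k. -/
theorem bumpCore_ge {X : ℝ} (hX : 2.5 ≤ X) : X - 2 ≤ bumpCore X := by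
  obtain ⟨d1, p1, q1, e1⟩ := gaussRel_eq (k := 1) (by norm_num) (by norm_num at hX ⊢; linarith)
    (exp_neg_pow_five_le hX)
  obtain ⟨d2, p2, q2, e2⟩ := gaussRel_eq (k := 2) (by norm_num) (by norm_num at hX ⊢; linarith)
    (exp_neg_pow_five_le hX)
  have hε : 0 < exp (-X) ^ 3 := by positivity
  rw [bumpCore, e1, e2]
  set ε := exp (-X) ^ 3
  norm_num at *
  nlinarith [mul_nonneg (show 0 ≤ X by linarith) p2, mul_nonneg hε.le (sub_nonneg.2 hX)]

theorem bumpCore_le {X : ℝ} (hX : 2.5 ≤ X) (hX' : X ≤ 5.5) :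
    bumpCore X ≤ X - 2 + exp (-X) ^ 3 * (16 * X - 7.99) := by
  obtain ⟨d1, p1, q1, e1⟩ := gaussRel_eq (k := 1) (by norm_num) (by norm_num at hX ⊢; linarith)
    (exp_neg_pow_five_le hX)
  obtain ⟨d2, p2, q2, e2⟩ := gaussRel_eq (k := 2) (by norm_num) (by norm_num at hX ⊢; linarith)
    (exp_neg_pow_five_le hX)
  have hε : 0 < exp (-X) ^ 3 := by positivity
  rw [bumpCore, e1, e2]
  set ε := exp (-X) ^ 3
  norm_num at *
  nlinarith [mul_nonneg (sub_nonneg.2 hX') p2]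

theorem bumpCore₁_le {X : ℝ} (hX : 2.5 ≤ X) : bumpCore₁ X ≤ 1 := by
  obtain ⟨d1, p1, q1, e1⟩ := gaussRel_eq (k := 1) (by norm_num) (by norm_num at hX ⊢; linarith)
    (exp_neg_pow_five_le hX)
  obtain ⟨d2, p2, q2, e2⟩ := gaussRel_eq (k := 2) (by norm_num) (by norm_num at hX ⊢; linarith)
    (exp_neg_pow_five_le hX)
  obtain ⟨d3, p3, q3, e3⟩ := gaussRel_eq (k := 3) (by norm_num) (by norm_num at hX ⊢; linarith)
    (exp_neg_pow_five_le hX)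
  have hε : 0 < exp (-X) ^ 3 := by positivity
  rw [bumpCore₁, e1, e2, e3]
  set ε := exp (-X) ^ 3
  norm_num at *
  have hX0 : 0 ≤ X := by linarith
  nlinarith [mul_nonneg hX0 p3, mul_le_mul_of_nonneg_left q2 hX0,
    mul_nonneg hε.le (sub_nonneg.2 hX)]

theorem bumpCore₁_ge {X : ℝ} (hX : 2.5 ≤ X) (hX' : X ≤ 5.5) :
    1 - exp (-X) ^ 3 * (48 * X - 39.95) ≤ bumpCore₁ X := by
  obtain ⟨d1, p1, q1, e1⟩ := gaussRel_eq (k := 1) (by norm_num) (by norm_num at hX ⊢; linarith)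
    (exp_neg_pow_five_le hX)
  obtain ⟨d2, p2, q2, e2⟩ := gaussRel_eq (k := 2) (by norm_num) (by norm_num at hX ⊢; linarith)
    (exp_neg_pow_five_le hX)
  obtain ⟨d3, p3, q3, e3⟩ := gaussRel_eq (k := 3) (by norm_num) (by norm_num at hX ⊢; linarith)
    (exp_neg_pow_five_le hX)
  have hε : 0 < exp (-X) ^ 3 := by positivity
  rw [bumpCore₁, e1, e2, e3]
  set ε := exp (-X) ^ 3
  norm_num at *
  have hX0 : 0 ≤ X := by linarith
  nlinarith [mul_nonneg hX0 p2, mul_nonneg (sub_nonneg.2 hX') p3]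

theorem bumpCore₂_bounds {X : ℝ} (hX : 2.5 ≤ X) (hX' : X ≤ 5.5) :
    0 ≤ bumpCore₂ X ∧ bumpCore₂ X ≤ exp (-X) ^ 3 * (144 * X - 167.65) := by
  obtain ⟨d1, p1, q1, e1⟩ := gaussRel_eq (k := 1) (by norm_num) (by norm_num at hX ⊢; linarith)
    (exp_neg_pow_five_le hX)
  obtain ⟨d2, p2, q2, e2⟩ := gaussRel_eq (k := 2) (by norm_num) (by norm_num at hX ⊢; linarith)
    (exp_neg_pow_five_le hX)
  obtain ⟨d3, p3, q3, e3⟩ := gaussRel_eq (k := 3) (by norm_num) (by norm_num at hX ⊢; linarith)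
    (exp_neg_pow_five_le hX)
  obtain ⟨d4, p4, q4, e4⟩ := gaussRel_eq (k := 4) (by norm_num) (by norm_num at hX ⊢; linarith)
    (exp_neg_pow_five_le hX)
  have hε : 0 < exp (-X) ^ 3 := by positivity
  rw [bumpCore₂, e1, e2, e3, e4]
  set ε := exp (-X) ^ 3
  norm_num at *
  have hX0 : 0 ≤ X := by linarith
  have a := sub_nonneg.2 hX'
  constructor
  · nlinarith [mul_nonneg hX0 p2, mul_nonneg hX0 p4, mul_nonneg a p3,
      mul_nonneg hε.le (sub_nonneg.2 hX)]
  · nlinarith [mul_nonneg a p2, mul_nonneg hX0 p3, mul_nonneg a p4]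

theorem bumpCore₃_ge {X : ℝ} (hX : 2.5 ≤ X) (hX' : X ≤ 5.5) :
    -(exp (-X) ^ 3 * (432 * X - 645)) ≤ bumpCore₃ X := by
  obtain ⟨d1, p1, q1, e1⟩ := gaussRel_eq (k := 1) (by norm_num) (by norm_num at hX ⊢; linarith)
    (exp_neg_pow_five_le hX)
  obtain ⟨d2, p2, q2, e2⟩ := gaussRel_eq (k := 2) (by norm_num) (by norm_num at hX ⊢; linarith)
    (exp_neg_pow_five_le hX)
  obtain ⟨d3, p3, q3, e3⟩ := gaussRel_eq (k := 3) (by norm_num) (by norm_num at hX ⊢; linarith)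
    (exp_neg_pow_five_le hX)
  obtain ⟨d4, p4, q4, e4⟩ := gaussRel_eq (k := 4) (by norm_num) (by norm_num at hX ⊢; linarith)
    (exp_neg_pow_five_le hX)
  obtain ⟨d5, p5, q5, e5⟩ := gaussRel_eq (k := 5) (by norm_num) (by norm_num at hX ⊢; linarith)
    (exp_neg_pow_five_le hX)
  have hε : 0 < exp (-X) ^ 3 := by positivity
  rw [bumpCore₃, e1, e2, e3, e4, e5]
  set ε := exp (-X) ^ 3
  norm_num at *
  have hX0 : 0 ≤ X := by linarith
  have a := sub_nonneg.2 hX'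
  nlinarith [mul_nonneg hX0 p2, mul_nonneg a p3, mul_nonneg hX0 p4, mul_nonneg a p5]

/-! ### Second and third logarithmic derivatives: growth on both sides of the mode -/

/-- Bounds for the normalised moments `Sₖ / S₀`. -/
theorem gaussMoment_ratio_bounds {k : ℕ} (hk : k + 1 ≤ 2) {X c : ℝ} (hX : 2.5 ≤ X)
    (hc : 2 + 32.002 * exp (-X) ^ 3 ≤ c) :
    0 ≤ gaussMoment (k + 1) X / gaussMoment 0 X ∧
    gaussMoment (k + 1) X / gaussMoment 0 X ≤ c * exp (-X) := by
  have hX0 : 0 < X := by norm_num at hX; linarith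
  have h0 := gaussMoment_pos 0 hX0
  refine ⟨(div_pos (gaussMoment_pos _ hX0) h0).le, ?_⟩
  rw [div_le_iff₀ h0]
  obtain ⟨d, p, q, e⟩ := gaussRel_eq (k := k + 1) (by omega)
    (by norm_num at hX ⊢; linarith) (exp_neg_pow_five_le hX)
  have h1 : 1 ≤ gaussMoment 0 X := by
    rw [gaussMoment_zero]; linarith [gaussTail_pos 0 hX0]
  have hE := exp_pos (-X)
  have hε : 0 < exp (-X) ^ 3 := by positivity
  have hc0 : 0 ≤ c := by linarith
  rw [gaussMoment_succ, gaussTail_eq_gaussRel, e]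
  have h4 : (4 : ℝ) ^ (k + 1) ≤ 16 := by
    calc (4 : ℝ) ^ (k + 1) ≤ 4 ^ 2 := pow_le_pow_right₀ (by norm_num) hk
      _ = 16 := by norm_num
  have h9 : (9 : ℝ) ^ (k + 1) ≤ 81 := by
    calc (9 : ℝ) ^ (k + 1) ≤ 9 ^ 2 := pow_le_pow_right₀ (by norm_num) hk
      _ = 81 := by norm_num
  have hd : d ≤ 0.001 * exp (-X) ^ 3 := by
    refine q.trans ?_
    have : (2 : ℝ) * 9 ^ (k + 1) * 0.000004 ≤ 0.001 := by norm_num at *; linarith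
    gcongr
  have h5 : 4 ^ (k + 1) * exp (-X) ^ 3 ≤ 16 * exp (-X) ^ 3 := by gcongr
  calc 2 * (exp (-X) * (1 + 4 ^ (k + 1) * exp (-X) ^ 3 + d))
      ≤ 2 * (exp (-X) * (1 + 16 * exp (-X) ^ 3 + 0.001 * exp (-X) ^ 3)) := by gcongr
    _ = exp (-X) * (2 + 32.002 * exp (-X) ^ 3) := by ring
    _ ≤ exp (-X) * c := by gcongr
    _ = c * exp (-X) * 1 := by ring
    _ ≤ c * exp (-X) * gaussMoment 0 X := by gcongr

/-- A criterion for `0 < logBump₃` on an interval `[x₀, x₁]` in terms of numerical bounds. -/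
theorem logBump₃_pos_of_bounds {X x₀ x₁ E y b c z : ℝ} (hx₀ : 2.5 ≤ x₀) (hx₁ : x₁ ≤ 5.5)
    (h₀ : x₀ ≤ X) (h₁ : X ≤ x₁) (hE : exp (-X) ≤ E) (hy : 1 ≤ y)
    (hY : E ^ 3 * (x₁ * (48 * x₁ - 39.95) + y * (16 * x₁ - 7.99)) ≤ x₁ - y * (x₁ - 2))
    (hB : x₁ ^ 2 * (E ^ 3 * (144 * x₁ - 167.65)) ≤ b * (x₀ - 2))
    (hC : x₁ ^ 3 * (E ^ 3 * (432 * x₁ - 645)) ≤ c * (x₀ - 2))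
    (hE2 : E ≤ 0.0821) (hz : 2.02 * E ≤ z) (hk : 0 ≤ 3 - x₀ + 3 * x₁ * z)
    (hpos : 0 ≤ 2 * y ^ 2 - y - 3 * b)
    (hfin : c + x₁ + x₁ ^ 2 * z * (3 - x₀ + 3 * x₁ * z) < (y - 1) * (2 * y ^ 2 - y - 3 * b)) :
    0 < logBump₃ X := by
  have hX : 2.5 ≤ X := hx₀.trans h₀
  have hX' : X ≤ 5.5 := h₁.trans hx₁
  have hn := bumpCore_ge hX
  have hn' := bumpCore_le hX hX'
  have hn1 := bumpCore₁_ge hX hX'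
  obtain ⟨hn2, hn2'⟩ := bumpCore₂_bounds hX hX'
  have hn3 := bumpCore₃_ge hX hX'
  have hε : exp (-X) ^ 3 ≤ E ^ 3 := by gcongr
  have hε0 : 0 < exp (-X) ^ 3 := by positivity
  have hc' : 2 + 32.002 * exp (-X) ^ 3 ≤ 2.02 := by
    have : E ^ 3 ≤ 0.0821 ^ 3 := by gcongr; exact (exp_pos _).le.trans hE
    norm_num at this ⊢; linarith
  obtain ⟨s1, s1'⟩ := gaussMoment_ratio_bounds (k := 0) (by norm_num) hX hc'
  obtain ⟨s2, s2'⟩ := gaussMoment_ratio_bounds (k := 1) (by norm_num) hX hc'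
  have hXp : 0 < X := by norm_num at hX; linarith
  have s3 : gaussMoment 2 X / gaussMoment 0 X ≤ gaussMoment 3 X / gaussMoment 0 X := by
    have := gaussMoment_pos 0 hXp
    have h' := gaussTail_le_succ 2 hXp
    gcongr
    rw [gaussMoment_succ, gaussMoment_succ]
    linarith
  norm_num at hX hX' hx₀ hx₁ hn1 hn2' hn3 hn' hY hB hC s1 s1' s2 s2'
  have hnpos : 0 < bumpCore X := by linarith
  have hx₁0 : 0 ≤ x₁ := by linarith
  have hE0 : 0 ≤ E := (exp_pos _).le.trans hE
  have hE3 : 0 ≤ E ^ 3 := by positivity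
  have hzE : 2.02 * exp (-X) ≤ z := by linarith
  norm_num at hzE
  have ht1 : gaussMoment 1 X / gaussMoment 0 X ≤ z := by linarith
  have ht2 : gaussMoment 2 X / gaussMoment 0 X ≤ z := by linarith
  -- In these quantities the core part of `logBump₃` factors as (Y - 1)(2Y² - Y - 3B) - C, which is
  -- monotone in Y, B and C in the relevant range. The hypotheses provide y ≤ Y, B ≤ b and C ≤ c.
  obtain ⟨Y, hYdef⟩ : ∃ Y, Y = X * (bumpCore₁ X / bumpCore X) := ⟨_, rfl⟩
  obtain ⟨B, hBdef⟩ : ∃ B, B = X ^ 2 * (bumpCore₂ X / bumpCore X) := ⟨_, rfl⟩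
  obtain ⟨C, hCdef⟩ : ∃ C, C = -(X ^ 3 * (bumpCore₃ X / bumpCore X)) := ⟨_, rfl⟩
  have hYy : y ≤ Y := by
    rw [hYdef, ← mul_div_assoc, le_div_iff₀ hnpos]
    have g1 : X * (48 * X - 799 / 20) + y * (16 * X - 799 / 100) ≤
        x₁ * (48 * x₁ - 799 / 20) + y * (16 * x₁ - 799 / 100) := by
      have a1 : X * (48 * X - 799 / 20) ≤ x₁ * (48 * x₁ - 799 / 20) := by
        apply mul_le_mul h₁ (by linarith) (by linarith) hx₁0
      have a2 : y * (16 * X - 799 / 100) ≤ y * (16 * x₁ - 799 / 100) := by gcongr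
      linarith
    have g2 : exp (-X) ^ 3 * (X * (48 * X - 799 / 20) + y * (16 * X - 799 / 100)) ≤
        E ^ 3 * (x₁ * (48 * x₁ - 799 / 20) + y * (16 * x₁ - 799 / 100)) := by
      refine mul_le_mul hε g1 ?_ hE3
      have : 0 ≤ X * (48 * X - 799 / 20) := mul_nonneg hXp.le (by linarith)
      have : 0 ≤ y * (16 * X - 799 / 100) := mul_nonneg (by linarith) (by linarith)
      linarith
    have g3 : x₁ - y * (x₁ - 2) ≤ X - y * (X - 2) := by
      have := mul_nonneg (sub_nonneg.2 hy) (sub_nonneg.2 h₁)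
      linarith
    have g4 := mul_le_mul_of_nonneg_left hn1 hXp.le
    have g5 := mul_le_mul_of_nonneg_left hn' (show 0 ≤ y by linarith)
    linarith
  have hb0 : 0 ≤ B := by
    rw [hBdef]; positivity
  have hx02 : 0 < x₀ - 2 := by linarith
  have hBb : B ≤ b := by
    rw [hBdef, ← mul_div_assoc, div_le_iff₀ hnpos]
    have g0 : 0 ≤ x₁ ^ 2 * (E ^ 3 * (144 * x₁ - 3353 / 20)) :=
      mul_nonneg (by positivity) (mul_nonneg hE3 (by linarith))
    have hb : 0 ≤ b := by
      have := g0.trans hB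
      exact nonneg_of_mul_nonneg_left this hx02
    calc X ^ 2 * bumpCore₂ X ≤ X ^ 2 * (exp (-X) ^ 3 * (144 * X - 3353 / 20)) := by gcongr
      _ ≤ x₁ ^ 2 * (E ^ 3 * (144 * x₁ - 3353 / 20)) := by
          have : 0 ≤ 144 * X - 3353 / 20 := by linarith
          gcongr
      _ ≤ b * (x₀ - 2) := hB
      _ ≤ b * bumpCore X := by gcongr; linarith
  have hCc : C ≤ c := by
    rw [hCdef, ← mul_div_assoc, neg_le, le_div_iff₀ hnpos]
    have g0 : 0 ≤ x₁ ^ 3 * (E ^ 3 * (432 * x₁ - 645)) :=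
      mul_nonneg (by positivity) (mul_nonneg hE3 (by linarith))
    have hc : 0 ≤ c := nonneg_of_mul_nonneg_left (g0.trans hC) hx02
    have g1 : X ^ 3 * (exp (-X) ^ 3 * (432 * X - 645)) ≤ c * bumpCore X := by
      calc _ ≤ x₁ ^ 3 * (E ^ 3 * (432 * x₁ - 645)) := by
            have : 0 ≤ 432 * X - 645 := by linarith
            gcongr
        _ ≤ c * (x₀ - 2) := hC
        _ ≤ c * bumpCore X := by gcongr; linarith
    have g2 := mul_le_mul_of_nonneg_left hn3 (show 0 ≤ X ^ 3 by positivity)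
    linarith
  set σ := gaussMoment 1 X / gaussMoment 0 X
  set t2 := gaussMoment 2 X / gaussMoment 0 X
  set t3 := gaussMoment 3 X / gaussMoment 0 X
  -- The positive terms Xσ, 3X²σ² and 2X³σ³ are dropped and t3 is replaced by the smaller t2, which
  -- leaves -X² t2 (3 - X + 3Xσ).
  have hS : -(x₁ ^ 2 * z * (3 - x₀ + 3 * x₁ * z)) ≤
      X * σ - 3 * X ^ 2 * (t2 - σ ^ 2) + X ^ 3 * (t3 - 3 * σ * t2 + 2 * σ ^ 3) := by
    have hz0 : 0 ≤ z := s1.trans ht1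
    have g1 : X ^ 2 * t2 * (3 - X + 3 * X * σ) ≤ x₁ ^ 2 * z * (3 - x₀ + 3 * x₁ * z) := by
      have k1 : X * σ ≤ x₁ * z := mul_le_mul h₁ ht1 s1 hx₁0
      have k2 : X ^ 2 * t2 ≤ x₁ ^ 2 * z := by gcongr
      calc _ ≤ X ^ 2 * t2 * (3 - x₀ + 3 * x₁ * z) := by
            refine mul_le_mul_of_nonneg_left (by linarith) (by positivity)
        _ ≤ _ := mul_le_mul_of_nonneg_right k2 hk
    have g2 : X ^ 3 * t2 ≤ X ^ 3 * t3 := by gcongr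
    have g3 : 0 ≤ X * σ := by positivity
    have g4 : 0 ≤ X ^ 2 * σ ^ 2 := by positivity
    have g5 : 0 ≤ X ^ 3 * σ ^ 3 := by positivity
    linarith
  have hmain : (y - 1) * (2 * y ^ 2 - y - 3 * b) ≤ (Y - 1) * (2 * Y ^ 2 - Y - 3 * B) := by
    refine mul_le_mul (by linarith) ?_ hpos (by linarith)
    linarith [mul_nonneg (sub_nonneg.2 hYy) (show 0 ≤ 2 * (Y + y) - 1 by linarith)]
  have hform : logBump₃ X = -X + ((Y - 1) * (2 * Y ^ 2 - Y - 3 * B)) - C +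
      (X * σ - 3 * X ^ 2 * (t2 - σ ^ 2) + X ^ 3 * (t3 - 3 * σ * t2 + 2 * σ ^ 3)) := by
    rw [logBump₃, hYdef, hBdef, hCdef]
    ring
  rw [hform]
  linarith

theorem logBump₃_pos {X : ℝ} (h₀ : 2.5 ≤ X) (h₁ : X ≤ 3.75) : 0 < logBump₃ X := by
  -- On each piece y is a lower bound for Y, b and c are upper bounds for B and C, and z bounds the
  -- first two moment ratios.
  rcases le_total X 2.8 with h | h
  · refine logBump₃_pos_of_bounds (x₀ := 2.5) (x₁ := 2.8) (E := 0.0821) (y := 3.2) (b := 2.2)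
      (c := 14) (z := 0.1659) (by norm_num) (by norm_num) h₀ h
      (exp_neg_div_le (p := 5) (q := 2) (by norm_num) (by norm_num) (by norm_num)
        (by norm_num at h₀ ⊢; linarith))
      ?_ ?_ ?_ ?_ ?_ ?_ ?_ ?_ ?_ <;> norm_num
  rcases le_total X 3.2 with h' | h'
  · refine logBump₃_pos_of_bounds (x₀ := 2.8) (x₁ := 3.2) (E := 0.06082) (y := 2.57) (b := 0.85)
      (c := 6.85) (z := 0.1229) (by norm_num) (by norm_num) h h'
      (exp_neg_div_le (p := 14) (q := 5) (by norm_num) (by norm_num) (by norm_num)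
        (by norm_num at h ⊢; linarith))
      ?_ ?_ ?_ ?_ ?_ ?_ ?_ ?_ ?_ <;> norm_num
  rcases le_total X 3.5 with h'' | h''
  · refine logBump₃_pos_of_bounds (x₀ := 3.2) (x₁ := 3.5) (E := 0.0408) (y := 2.3) (b := 0.25)
      (c := 2.2) (z := 0.0825) (by norm_num) (by norm_num) h' h''
      (exp_neg_div_le (p := 16) (q := 5) (by norm_num) (by norm_num) (by norm_num)
        (by norm_num at h' ⊢; linarith))
      ?_ ?_ ?_ ?_ ?_ ?_ ?_ ?_ ?_ <;> norm_num
  · refine logBump₃_pos_of_bounds (x₀ := 3.5) (x₁ := 3.75) (E := 0.0302) (y := 2.12) (b := 0.12)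
      (c := 1) (z := 0.0611) (by norm_num) (by norm_num) h'' h₁
      (exp_neg_div_le (p := 7) (q := 2) (by norm_num) (by norm_num) (by norm_num)
        (by norm_num at h'' ⊢; linarith))
      ?_ ?_ ?_ ?_ ?_ ?_ ?_ ?_ ?_ <;> norm_num

theorem gaussMoment_zero_bounds {X : ℝ} (hX : 2.5 ≤ X) :
    1 + 2 * exp (-X) * (1 + exp (-X) ^ 3) ≤ gaussMoment 0 X ∧
    gaussMoment 0 X ≤ 1 + 2 * exp (-X) * (1 + 1.00001 * exp (-X) ^ 3) := by
  obtain ⟨d, p, q, e⟩ := gaussRel_eq (k := 0) (by norm_num) (by norm_num at hX ⊢; linarith)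
    (exp_neg_pow_five_le hX)
  have hE := exp_pos (-X)
  have hε : 0 < exp (-X) ^ 3 := by positivity
  rw [gaussMoment_zero, gaussTail_eq_gaussRel, e]
  norm_num at q ⊢
  constructor
  · nlinarith
  · nlinarith

theorem gaussMoment_one_bounds {X : ℝ} (hX : 2.5 ≤ X) :
    2 * exp (-X) * (1 + 4 * exp (-X) ^ 3) ≤ gaussMoment 1 X ∧
    gaussMoment 1 X ≤ 2 * exp (-X) * (1 + 4.0001 * exp (-X) ^ 3) := by
  obtain ⟨d, p, q, e⟩ := gaussRel_eq (k := 1) (by norm_num) (by norm_num at hX ⊢; linarith)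
    (exp_neg_pow_five_le hX)
  have hE := exp_pos (-X)
  have hε : 0 < exp (-X) ^ 3 := by positivity
  rw [gaussMoment_succ, gaussTail_eq_gaussRel, e]
  norm_num at q ⊢
  constructor
  · nlinarith
  · nlinarith

/-- The point 3.54 is just to the right of the mode. As `logBump₂` increases on [2.5, 3.75], this
one value bounds it everywhere to the left of the mode, just below the bound -6.8 of `logBump₂_ge`.
-/
theorem logBump₂_le : logBump₂ 3.54 ≤ -6.81 := by
  have hEu : exp (-3.54) ≤ 0.0291 :=
    exp_neg_div_le (p := 177) (q := 50) (by norm_num) (by norm_num) (by norm_num) (by norm_num)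
  have hEl : 0.0289 ≤ exp (-3.54) :=
    le_exp_neg_div (p := 177) (q := 50) (by norm_num) (by norm_num) (by norm_num) (by norm_num)
  have hn := bumpCore_ge (X := 3.54) (by norm_num)
  have hn' := bumpCore_le (X := 3.54) (by norm_num) (by norm_num)
  have hn1 := bumpCore₁_ge (X := 3.54) (by norm_num) (by norm_num)
  obtain ⟨hn2, hn2'⟩ := bumpCore₂_bounds (X := 3.54) (by norm_num) (by norm_num)
  obtain ⟨-, a0⟩ := gaussMoment_zero_bounds (X := 3.54) (by norm_num)
  obtain ⟨b0, -⟩ := gaussMoment_one_bounds (X := 3.54) (by norm_num)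
  have h0 := gaussMoment_pos 0 (show (0 : ℝ) < 3.54 by norm_num)
  have hε : exp (-3.54) ^ 3 ≤ 0.0291 ^ 3 := by gcongr
  have hε0 : 0 < exp (-3.54) ^ 3 := by positivity
  obtain ⟨s1, s1'⟩ := gaussMoment_ratio_bounds (k := 0) (X := 3.54) (c := 2.01) (by norm_num)
    (by norm_num) (by norm_num at hε ⊢; linarith)
  have hs12 : gaussMoment 1 3.54 / gaussMoment 0 3.54 ≤
      gaussMoment 2 3.54 / gaussMoment 0 3.54 := by
    have h' := gaussTail_le_succ 1 (show (0 : ℝ) < 3.54 by norm_num)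
    gcongr
    rw [gaussMoment_succ, gaussMoment_succ]
    linarith
  have hσ : 0.0545 ≤ gaussMoment 1 3.54 / gaussMoment 0 3.54 := by
    rw [le_div_iff₀ h0]
    norm_num at *
    nlinarith
  have hnpos : 0 < bumpCore 3.54 := by norm_num at hn ⊢; linarith
  have hY : 2.285 ≤ 3.54 * (bumpCore₁ 3.54 / bumpCore 3.54) := by
    rw [← mul_div_assoc, le_div_iff₀ hnpos]
    norm_num at *
    linarith
  have hB : 3.54 ^ 2 * (bumpCore₂ 3.54 / bumpCore 3.54) ≤ 0.07 := by
    rw [← mul_div_assoc, div_le_iff₀ hnpos]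
    norm_num at *
    linarith
  rw [logBump₂]
  generalize gaussMoment 1 3.54 / gaussMoment 0 3.54 = σ at *
  generalize gaussMoment 2 3.54 / gaussMoment 0 3.54 = t at *
  generalize bumpCore₁ 3.54 / bumpCore 3.54 = L at *
  generalize bumpCore₂ 3.54 / bumpCore 3.54 = R at *
  have hσ' : σ ≤ 0.059 := by norm_num at *; linarith
  clear hn hn' hn1 hn2 hn2' a0 b0 h0 hnpos hε hε0 s1' s1
  norm_num at *
  have h1 := mul_nonneg (sub_nonneg.2 hY) (show 0 ≤ 177 / 50 * L + 457 / 200 - 1 by linarith)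
  have h2 := mul_nonneg (sub_nonneg.2 hσ) (sub_nonneg.2 hσ')
  linarith

/-- On [0, X/(X-2)] the concave function t - t² is smallest at the right end, where it equals
-2X/(X-2)²; A is a bound for X + 2X/(X-2)². -/
theorem neg_le_of_log_slope_le {X L A : ℝ} (hX : 2 < X) (hL0 : 0 ≤ L) (hL : L ≤ 1 / (X - 2))
    (hA : X * (X - 2) ^ 2 + 2 * X ≤ A * (X - 2) ^ 2) : -A ≤ -X + (X * L - (X * L) ^ 2) := by
  obtain ⟨v, hv⟩ : ∃ v, v = X - 2 := ⟨_, rfl⟩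
  have hv0 : 0 < v := by linarith
  obtain rfl : X = v + 2 := by linarith
  rw [← hv] at hL hA
  have h1 : L * v ≤ 1 := by rwa [le_div_iff₀ hv0] at hL
  refine le_of_mul_le_mul_right ?_ (pow_pos hv0 2)
  have h2 : 0 ≤ L * v := by positivity
  have h3 := mul_nonneg (mul_nonneg (show 0 ≤ v + 2 by linarith) (sub_nonneg.2 h1))
    (show 0 ≤ v + 2 + (v + 2) * (L * v) - v by nlinarith)
  linarith

/-- The nonnegative contributions of `bumpCore₂` and of (S₁/S₀)² are discarded. Then A controls the
core part, since the core is at least X - 2 with slope at most 1, and the remaining theta part is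
bounded with `x₁` and E. -/
theorem logBump₂_ge_of_bounds {X x₀ x₁ E A : ℝ} (hx₀ : 3.75 ≤ x₀) (hx₁ : x₁ ≤ 5.5)
    (h₀ : x₀ ≤ X) (h₁ : X ≤ x₁) (hE : exp (-X) ≤ E)
    (hA : X * (X - 2) ^ 2 + 2 * X ≤ A * (X - 2) ^ 2)
    (hfin : (2.001 * x₁ ^ 2 - 2 * x₁) * E + A ≤ 6.8) : -6.8 ≤ logBump₂ X := by
  have hX : 3.75 ≤ X := hx₀.trans h₀
  have hX2 : 2.5 ≤ X := by norm_num at hX ⊢; linarith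
  have hX' : X ≤ 5.5 := h₁.trans hx₁
  have hn := bumpCore_ge hX2
  have hn1 := bumpCore₁_ge hX2 hX'
  have hn1' := bumpCore₁_le hX2
  obtain ⟨hn2, -⟩ := bumpCore₂_bounds hX2 hX'
  have hXp : 0 < X := by norm_num at hX; linarith
  have h0 := gaussMoment_pos 0 hXp
  have h1 : 1 ≤ gaussMoment 0 X := by
    rw [gaussMoment_zero]; linarith [gaussTail_pos 0 hXp]
  have hEp := exp_pos (-X)
  have hEsmall : exp (-X) ≤ 0.0236 :=
    exp_neg_div_le (p := 15) (q := 4) (by norm_num) (by norm_num) (by norm_num)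
      (by norm_num at hX ⊢; linarith)
  have hε : exp (-X) ^ 3 ≤ 0.0236 ^ 3 := by gcongr
  have hε0 : 0 < exp (-X) ^ 3 := by positivity
  obtain ⟨s2, s2'⟩ := gaussMoment_ratio_bounds (k := 1) (c := 2.001) (by norm_num) hX2
    (by norm_num at hε ⊢; linarith)
  have hB : 0 ≤ bumpCore₂ X / bumpCore X := div_nonneg hn2 (bumpCore_pos (by
    norm_num at hX; linarith)).le
  norm_num at *
  have hnpos : 0 < bumpCore X := by linarith
  have hL0 : 0 ≤ bumpCore₁ X := by nlinarith
  have hL : bumpCore₁ X / bumpCore X ≤ 1 / (X - 2) := by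
    rw [div_le_div_iff₀ hnpos (by linarith)]
    nlinarith
  have hL0' : 0 ≤ bumpCore₁ X / bumpCore X := by positivity
  have hS : X ^ 2 * (gaussMoment 2 X / gaussMoment 0 X) - X * (gaussMoment 1 X / gaussMoment 0 X) ≤
      (2.001 * X ^ 2 - 2 * X) * exp (-X) := by
    rw [← mul_div_assoc, ← mul_div_assoc, ← sub_div, div_le_iff₀ h0]
    obtain ⟨d, p, q, e⟩ := gaussRel_eq (k := 2) (by norm_num) (show 1.9 ≤ X by norm_num; linarith)
      (exp_neg_pow_five_le (X := X) (by norm_num; linarith))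
    obtain ⟨b0, -⟩ := gaussMoment_one_bounds (X := X) (by norm_num; linarith)
    have g1 : gaussMoment 2 X ≤ 2.001 * exp (-X) := by
      rw [gaussMoment_succ, gaussTail_eq_gaussRel, e]
      norm_num at *
      nlinarith
    have g2 : 2 * exp (-X) ≤ gaussMoment 1 X := by nlinarith [mul_pos hEp hε0]
    have g3 : 0 ≤ (2.001 * X ^ 2 - 2 * X) * exp (-X) :=
      mul_nonneg (by norm_num; nlinarith) hEp.le
    have g4 := mul_le_mul_of_nonneg_left g1 (sq_nonneg X)
    have g5 := mul_le_mul_of_nonneg_left g2 hXp.le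
    have g6 := mul_le_mul_of_nonneg_left h1 g3
    linarith
  have hS2 : (2.001 * X ^ 2 - 2 * X) * exp (-X) ≤ (2.001 * x₁ ^ 2 - 2 * x₁) * E := by
    refine mul_le_mul ?_ hE hEp.le ?_
    · norm_num; nlinarith
    · norm_num; nlinarith
  have hY := neg_le_of_log_slope_le (by linarith) hL0' hL hA
  have hσ : 0 ≤ X ^ 2 * (gaussMoment 1 X / gaussMoment 0 X) ^ 2 := by positivity
  have hB' := mul_nonneg (sq_nonneg X) hB
  have hform : logBump₂ X = -X + (X * (bumpCore₁ X / bumpCore X) -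
      (X * (bumpCore₁ X / bumpCore X)) ^ 2) + X ^ 2 * (bumpCore₂ X / bumpCore X) -
      (X ^ 2 * (gaussMoment 2 X / gaussMoment 0 X) - X * (gaussMoment 1 X / gaussMoment 0 X)) +
      X ^ 2 * (gaussMoment 1 X / gaussMoment 0 X) ^ 2 := by
    rw [logBump₂]; ring
  rw [hform]
  clear hform
  norm_num at hS hS2 hfin ⊢
  linarith

theorem logBump₂_ge {X : ℝ} (h₀ : 3.75 ≤ X) (h₁ : X ≤ 5.5) : -6.8 ≤ logBump₂ X := by
  rcases le_total X 3.95 with h | h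
  · refine logBump₂_ge_of_bounds (x₀ := 3.75) (x₁ := 3.95) (E := 0.02352) (A := 6.2) (by norm_num)
      (by norm_num) h₀ h (exp_neg_div_le (p := 15) (q := 4) (by norm_num) (by norm_num)
        (by norm_num) (by norm_num at h₀ ⊢; linarith)) ?_ (by norm_num)
    norm_num at *
    nlinarith [mul_nonneg (sub_nonneg.2 h₀) (sub_nonneg.2 h)]
  rcases le_total X 4.6 with h' | h'
  · refine logBump₂_ge_of_bounds (x₀ := 3.95) (x₁ := 4.6) (E := 0.01926) (A := 6.04) (by norm_num)
      (by norm_num) h h' (exp_neg_div_le (p := 79) (q := 20) (by norm_num) (by norm_num)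
        (by norm_num) (by norm_num at h ⊢; linarith)) ?_ (by norm_num)
    norm_num at *
    nlinarith [mul_nonneg (sub_nonneg.2 h) (sub_nonneg.2 h')]
  rcases le_total X 5.1 with h'' | h''
  · refine logBump₂_ge_of_bounds (x₀ := 4.6) (x₁ := 5.1) (E := 0.01006) (A := 6.2) (by norm_num)
      (by norm_num) h' h'' (exp_neg_div_le (p := 23) (q := 5) (by norm_num) (by norm_num)
        (by norm_num) (by norm_num at h' ⊢; linarith)) ?_ (by norm_num)
    norm_num at *
    nlinarith [mul_nonneg (sub_nonneg.2 h') (sub_nonneg.2 h'')]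
  · refine logBump₂_ge_of_bounds (x₀ := 5.1) (x₁ := 5.5) (E := 0.0061) (A := 6.41) (by norm_num)
      (by norm_num) h'' h₁ (exp_neg_div_le (p := 51) (q := 10) (by norm_num) (by norm_num)
        (by norm_num) (by norm_num at h'' ⊢; linarith)) ?_ (by norm_num)
    norm_num at *
    nlinarith [mul_nonneg (sub_nonneg.2 h'') (sub_nonneg.2 h₁)]

/-! ### Sign of the first logarithmic derivative and location of the mode -/

theorem mul_exp_neg_le {X : ℝ} (hX : 3.5 ≤ X) : X * exp (-X) ≤ 0.1058 := by
  have h1 : exp (-3.5) ≤ 0.0302 :=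
    exp_neg_div_le (p := 7) (q := 2) (by norm_num) (by norm_num) (by norm_num) (by norm_num)
  have h2 : exp (-X) * (X - 2.5) ≤ exp (-3.5) := by
    have h3 : X - 2.5 ≤ exp (X - 3.5) := by
      have := Real.add_one_le_exp (X - 3.5); norm_num at *; linarith
    calc exp (-X) * (X - 2.5) ≤ exp (-X) * exp (X - 3.5) := by gcongr
      _ = exp (-3.5) := by rw [← Real.exp_add]; ring_nf
  have hE := exp_pos (-X)
  have h4 : exp (-X) * X ≤ 3.5 * (exp (-X) * (X - 2.5)) := by
    have : X ≤ 3.5 * (X - 2.5) := by norm_num at *; linarith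
    calc exp (-X) * X ≤ exp (-X) * (3.5 * (X - 2.5)) := by gcongr
      _ = _ := by ring
  norm_num at *
  linarith

/-- Here `logBump₁` is at most 1 - X + X/(X-2) + X S₁/S₀; for X ≥ 3.54 the last two terms are at
most 2.299 and 0.212. -/
theorem logBump₁_neg_of_ge {X : ℝ} (hX : 3.54 ≤ X) : logBump₁ X < 0 := by
  have hX2 : 2.5 ≤ X := by norm_num at *; linarith
  have hXp : 0 < X := by norm_num at *; linarith
  have hn := bumpCore_ge hX2
  have hn1 := bumpCore₁_le hX2
  have hEsmall : exp (-X) ≤ 0.0302 :=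
    exp_neg_div_le (p := 7) (q := 2) (by norm_num) (by norm_num) (by norm_num)
      (by norm_num at hX ⊢; linarith)
  have hε : exp (-X) ^ 3 ≤ 0.0302 ^ 3 := by gcongr
  obtain ⟨-, s1⟩ := gaussMoment_ratio_bounds (k := 0) (c := 2.001) (by norm_num) hX2
    (by norm_num at hε ⊢; linarith)
  have hXE := mul_exp_neg_le (X := X) (by norm_num at *; linarith)
  have hL : X * (bumpCore₁ X / bumpCore X) ≤ 2299 / 1000 := by
    norm_num at hX
    rw [← mul_div_assoc, div_le_iff₀ (by linarith)]
    have := mul_le_mul_of_nonneg_left hn1 hXp.le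
    linarith
  have hS := mul_le_mul_of_nonneg_left s1 hXp.le
  rw [logBump₁]
  norm_num at *
  linarith

/-- Sharp two-sided bounds for the quantities in `logBump₁`, for `X ≥ 3.5`. -/
theorem sharp_bounds {X : ℝ} (hX : 3.5 ≤ X) (hX' : X ≤ 4) :
    X - 2 + exp (-X) ^ 3 * (16 * X - 8.001) ≤ bumpCore X ∧
    bumpCore X ≤ X - 2 + exp (-X) ^ 3 * (16 * X - 7.999) ∧
    1 - exp (-X) ^ 3 * (48 * X - 39.999) ≤ bumpCore₁ X ∧
    bumpCore₁ X ≤ 1 - exp (-X) ^ 3 * (48 * X - 40.001) := by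
  have hc : exp (-X) ^ 5 ≤ 0.00000003 := by
    have h : exp (-X) ≤ 0.0302 :=
      exp_neg_div_le (p := 7) (q := 2) (by norm_num) (by norm_num) (by norm_num)
        (by norm_num at hX ⊢; linarith)
    calc exp (-X) ^ 5 ≤ 0.0302 ^ 5 := by gcongr
      _ ≤ 0.00000003 := by norm_num
  have hX1 : 1.9 ≤ X := by norm_num at *; linarith
  obtain ⟨d1, p1, q1, e1⟩ := gaussRel_eq (k := 1) (by norm_num) hX1 hc
  obtain ⟨d2, p2, q2, e2⟩ := gaussRel_eq (k := 2) (by norm_num) hX1 hc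
  obtain ⟨d3, p3, q3, e3⟩ := gaussRel_eq (k := 3) (by norm_num) hX1 hc
  have hε : 0 < exp (-X) ^ 3 := by positivity
  rw [bumpCore, bumpCore₁, e1, e2, e3]
  set ε := exp (-X) ^ 3
  norm_num at *
  have hX0 : 0 ≤ X := by linarith
  have k1 := mul_nonneg hX0 p2
  have k2 := mul_nonneg hX0 p3
  have k3 := mul_nonneg (sub_nonneg.2 hX') p2
  have k4 := mul_nonneg (sub_nonneg.2 hX') p3
  refine ⟨?_, ?_, ?_, ?_⟩ <;> linarith

/-- The rational part and the theta part of `logBump₁` bounded below on a short interval. -/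
theorem logBump₁_ge_of_bounds {X lo hi E₀ E₁ y s : ℝ} (hlo : 3.5 ≤ lo) (hhi : hi ≤ 4)
    (h₀ : lo ≤ X) (h₁ : X ≤ hi) (hE₀ : E₀ ≤ exp (-X)) (hE₁ : exp (-X) ≤ E₁) (hE₀0 : 0 ≤ E₀)
    (hy : 1 ≤ y) (hs : 0 ≤ s)
    (hY : E₁ ^ 3 * (hi * (48 * hi - 39.999) + y * (16 * hi - 7.999)) ≤ hi - y * (hi - 2))
    (hS : s * (1 + 2 * E₁ * (1 + 1.00001 * E₁ ^ 3)) ≤ lo * (2 * E₀ * (1 + 4 * E₀ ^ 3))) :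
    1 - hi + y + s ≤ logBump₁ X := by
  have hX : 3.5 ≤ X := hlo.trans h₀
  have hX' : X ≤ 4 := h₁.trans hhi
  have hXp : 0 < X := by norm_num at *; linarith
  obtain ⟨-, n2, n3, -⟩ := sharp_bounds hX hX'
  have hnpos := bumpCore_pos (X := X) (by norm_num at *; linarith)
  obtain ⟨-, a0⟩ := gaussMoment_zero_bounds (X := X) (by norm_num at *; linarith)
  obtain ⟨b0, -⟩ := gaussMoment_one_bounds (X := X) (by norm_num at *; linarith)
  have hE0 := exp_pos (-X)
  have hE10 : 0 ≤ E₁ := hE0.le.trans hE₁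
  have hhi0 : 0 ≤ hi := by linarith
  have hL : y ≤ X * (bumpCore₁ X / bumpCore X) := by
    rw [← mul_div_assoc, le_div_iff₀ hnpos]
    have hε : exp (-X) ^ 3 ≤ E₁ ^ 3 := by gcongr
    norm_num at hlo hX n2 n3 hY
    have g2 : exp (-X) ^ 3 * (X * (48 * X - 39999 / 1000) + y * (16 * X - 7999 / 1000)) ≤
        E₁ ^ 3 * (hi * (48 * hi - 39999 / 1000) + y * (16 * hi - 7999 / 1000)) := by
      have : 0 ≤ 48 * X - 39999 / 1000 := by linarith
      have : 0 ≤ 16 * X - 7999 / 1000 := by linarith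
      gcongr
    have g3 := mul_nonneg (sub_nonneg.2 hy) (sub_nonneg.2 h₁)
    have g4 := mul_le_mul_of_nonneg_left n3 hXp.le
    have g5 := mul_le_mul_of_nonneg_left n2 (show 0 ≤ y by linarith)
    linarith
  have hσ : s ≤ X * (gaussMoment 1 X / gaussMoment 0 X) := by
    rw [← mul_div_assoc, le_div_iff₀ (gaussMoment_pos 0 hXp)]
    calc s * gaussMoment 0 X ≤ s * (1 + 2 * exp (-X) * (1 + 1.00001 * exp (-X) ^ 3)) := by gcongr
      _ ≤ s * (1 + 2 * E₁ * (1 + 1.00001 * E₁ ^ 3)) := by gcongr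
      _ ≤ _ := hS
      _ ≤ X * (2 * exp (-X) * (1 + 4 * exp (-X) ^ 3)) := by gcongr
      _ ≤ X * gaussMoment 1 X := by gcongr
  rw [logBump₁]
  linarith

/-- The rational part and the theta part of `logBump₁` bounded above on a short interval. -/
theorem logBump₁_le_of_bounds {X lo hi E₀ E₁ y s : ℝ} (hlo : 3.5 ≤ lo) (hhi : hi ≤ 4)
    (h₀ : lo ≤ X) (h₁ : X ≤ hi) (hE₀ : E₀ ≤ exp (-X)) (hE₁ : exp (-X) ≤ E₁) (hE₀0 : 0 ≤ E₀)
    (hy : 1 ≤ y) (hs : 0 ≤ s)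
    (hY : lo - y * (lo - 2) ≤ E₀ ^ 3 * (lo * (48 * lo - 40.001) + y * (16 * lo - 8.001)))
    (hS : hi * (2 * E₁ * (1 + 4.0001 * E₁ ^ 3)) ≤ s * (1 + 2 * E₀ * (1 + E₀ ^ 3))) :
    logBump₁ X ≤ 1 - lo + y + s := by
  have hX : 3.5 ≤ X := hlo.trans h₀
  have hX' : X ≤ 4 := h₁.trans hhi
  have hXp : 0 < X := by norm_num at *; linarith
  obtain ⟨n1, -, -, n4⟩ := sharp_bounds hX hX'
  have hnpos := bumpCore_pos (X := X) (by norm_num at *; linarith)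
  obtain ⟨a0, -⟩ := gaussMoment_zero_bounds (X := X) (by norm_num at *; linarith)
  obtain ⟨-, b0⟩ := gaussMoment_one_bounds (X := X) (by norm_num at *; linarith)
  have hE0 := exp_pos (-X)
  have hE10 : 0 ≤ E₁ := hE0.le.trans hE₁
  have hhi0 : 0 ≤ hi := by linarith
  have hL : X * (bumpCore₁ X / bumpCore X) ≤ y := by
    rw [← mul_div_assoc, div_le_iff₀ hnpos]
    have hε : E₀ ^ 3 ≤ exp (-X) ^ 3 := by gcongr
    norm_num at hlo hX n1 n4 hY
    have g2 : E₀ ^ 3 * (lo * (48 * lo - 40001 / 1000) + y * (16 * lo - 8001 / 1000)) ≤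
        exp (-X) ^ 3 * (X * (48 * X - 40001 / 1000) + y * (16 * X - 8001 / 1000)) := by
      have : 0 ≤ 48 * lo - 40001 / 1000 := by linarith
      have : 0 ≤ 16 * lo - 8001 / 1000 := by linarith
      gcongr
    have g3 := mul_nonneg (sub_nonneg.2 hy) (sub_nonneg.2 h₀)
    have g4 := mul_le_mul_of_nonneg_left n4 hXp.le
    have g5 := mul_le_mul_of_nonneg_left n1 (show 0 ≤ y by linarith)
    linarith
  have hσ : X * (gaussMoment 1 X / gaussMoment 0 X) ≤ s := by
    rw [← mul_div_assoc, div_le_iff₀ (gaussMoment_pos 0 hXp)]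
    calc X * gaussMoment 1 X ≤ X * (2 * exp (-X) * (1 + 4.0001 * exp (-X) ^ 3)) := by gcongr
      _ ≤ hi * (2 * E₁ * (1 + 4.0001 * E₁ ^ 3)) := by gcongr
      _ ≤ _ := hS
      _ ≤ s * (1 + 2 * exp (-X) * (1 + exp (-X) ^ 3)) := by gcongr
      _ ≤ s * gaussMoment 0 X := by gcongr
  rw [logBump₁]
  linarith

theorem exp_neg_near {h : ℝ} (h0 : 0 ≤ h) (h1 : h ≤ 1) :
    1 - h + h ^ 2 / 2 - h ^ 3 / 6 - h ^ 4 * (5 / 96) ≤ exp (-h) ∧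
    exp (-h) ≤ 1 - h + h ^ 2 / 2 - h ^ 3 / 6 + h ^ 4 * (5 / 96) := by
  have key := Real.exp_bound (x := -h) (by rw [abs_neg, abs_of_nonneg h0]; exact h1)
    (n := 4) (by norm_num)
  rw [abs_neg, abs_of_nonneg h0, abs_le] at key
  simp only [Finset.sum_range_succ, Finset.sum_range_zero] at key
  norm_num [Nat.factorial] at key
  constructor <;> linarith [key.1, key.2]

theorem exp_neg_three_half : 0.0301973834 ≤ exp (-3.5) ∧ exp (-3.5) ≤ 0.0301973835 :=
  ⟨le_exp_neg_div (p := 7) (q := 2) (by norm_num) (by norm_num) (by norm_num) (by norm_num),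
    exp_neg_div_le (p := 7) (q := 2) (by norm_num) (by norm_num) (by norm_num) (by norm_num)⟩

/-- The endpoints near 3.5113 have denominators too large for the power trick of `exp_neg_div_le`,
so exp(-3.5) is bounded that way and the small shift by a Taylor polynomial. -/
theorem exp_neg_shift_bounds {X lo hi : ℝ} (hlo : 3.5 ≤ lo) (hhi : hi ≤ 4)
    (h₀ : lo ≤ X) (h₁ : X ≤ hi) :
    0.0301973834 * (1 - (hi - 3.5) + (hi - 3.5) ^ 2 / 2 - (hi - 3.5) ^ 3 / 6 -
      (hi - 3.5) ^ 4 * (5 / 96)) ≤ exp (-X) ∧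
    exp (-X) ≤ 0.0301973835 * (1 - (lo - 3.5) + (lo - 3.5) ^ 2 / 2 - (lo - 3.5) ^ 3 / 6 +
      (lo - 3.5) ^ 4 * (5 / 96)) := by
  obtain ⟨c0, c1⟩ := exp_neg_three_half
  obtain ⟨a0, -⟩ := exp_neg_near (h := hi - 3.5) (by linarith) (by norm_num at *; linarith)
  obtain ⟨-, a1⟩ := exp_neg_near (h := lo - 3.5) (by linarith) (by norm_num at *; linarith)
  constructor
  · calc _ ≤ 0.0301973834 * exp (-(hi - 3.5)) := by gcongr
      _ ≤ exp (-3.5) * exp (-(hi - 3.5)) := by gcongr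
      _ = exp (-hi) := by rw [← Real.exp_add]; ring_nf
      _ ≤ exp (-X) := by gcongr
  · calc exp (-X) ≤ exp (-lo) := by gcongr
      _ = exp (-3.5) * exp (-(lo - 3.5)) := by rw [← Real.exp_add]; ring_nf
      _ ≤ 0.0301973835 * exp (-(lo - 3.5)) := by gcongr
      _ ≤ _ := by gcongr

/-- The certified margins here and in `logBump₁_neg_right` are only 3.9·10⁻⁶ and 2.7·10⁻⁶, which is
why y, s and the endpoints are given to seven decimals. -/
theorem logBump₁_pos_left : 0 < logBump₁ (π / 0.894705) := by
  have hp := Real.pi_gt_d20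
  have hp' := Real.pi_lt_d20
  have h0 : 3.5113167 ≤ π / 0.894705 := by
    rw [le_div_iff₀ (by norm_num)]; norm_num at *; linarith
  have h1 : π / 0.894705 ≤ 3.5113168 := by
    rw [div_le_iff₀ (by norm_num)]; norm_num at *; linarith
  obtain ⟨e0, e1⟩ := exp_neg_shift_bounds (by norm_num) (by norm_num) h0 h1
  have h := logBump₁_ge_of_bounds (E₀ := 0.02985757) (E₁ := 0.02985758) (y := 2.3134368)
    (s := 0.1978839) (by norm_num) (by norm_num) h0 h1 (le_trans (by norm_num) e0)
    (e1.trans (by norm_num)) (by norm_num) (by norm_num) (by norm_num) (by norm_num) (by norm_num)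
  refine lt_of_lt_of_le ?_ h
  norm_num

theorem logBump₁_neg_right : logBump₁ (π / 0.894704) < 0 := by
  have hp := Real.pi_gt_d20
  have hp' := Real.pi_lt_d20
  have h0 : 3.5113206 ≤ π / 0.894704 := by
    rw [le_div_iff₀ (by norm_num)]; norm_num at *; linarith
  have h1 : π / 0.894704 ≤ 3.5113207 := by
    rw [div_le_iff₀ (by norm_num)]; norm_num at *; linarith
  obtain ⟨e0, e1⟩ := exp_neg_shift_bounds (by norm_num) (by norm_num) h0 h1
  have h := logBump₁_le_of_bounds (E₀ := 0.02985745) (E₁ := 0.02985746) (y := 2.3134341)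
    (s := 0.1978838) (by norm_num) (by norm_num) h0 h1 (le_trans (by norm_num) e0)
    (e1.trans (by norm_num)) (by norm_num) (by norm_num) (by norm_num) (by norm_num) (by norm_num)
  refine lt_of_le_of_lt h ?_
  norm_num

/-! ### Values and slopes of bump away from the mode -/

theorem mul_sub_mul_exp_neg_le {Z : ℝ} (hZ : 5.1875 ≤ Z) :
    (1.00001 * Z ^ 2 - Z) * exp (-Z) ≤ 0.125 := by
  have h1 : exp (-5.1875) ≤ 0.00559 :=
    exp_neg_div_le (p := 83) (q := 16) (by norm_num) (by norm_num) (by norm_num) (by norm_num)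
  obtain ⟨h, rfl⟩ : ∃ h, Z = 5.1875 + h := ⟨Z - 5.1875, by ring⟩
  have hh : 0 ≤ h := by linarith
  have h2 := Real.quadratic_le_exp_of_nonneg hh
  have h3 : 1.00001 * (5.1875 + h) ^ 2 - (5.1875 + h) ≤ 22 * exp h := by
    refine le_trans ?_ (mul_le_mul_of_nonneg_left h2 (by norm_num))
    norm_num
    nlinarith
  calc _ ≤ (22 * exp h) * exp (-(5.1875 + h)) := by gcongr
    _ = 22 * exp (-5.1875) := by
        rw [mul_assoc, ← Real.exp_add]; ring_nf
    _ ≤ 22 * 0.00559 := by gcongr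
    _ ≤ 0.125 := by norm_num

/-- After inversion to Z = π²/X ≥ 5.1875 the sign is that of Z² S₂ - Z S₁ - S₀/4. The last term is
at least 1/4 in size and outweighs the others, which are about 2(Z² - Z) exp(-Z). -/
theorem bump_nonpos {X : ℝ} (hX0 : 0 < X) (hX : X ≤ 1.9) : bump X ≤ 0 := by
  obtain ⟨Z, hZdef⟩ : ∃ Z, Z = π ^ 2 / X := ⟨_, rfl⟩
  have hpi := Real.pi_gt_d4
  have hZ : 5.1875 ≤ Z := by
    rw [hZdef, le_div_iff₀ hX0]
    norm_num at *
    nlinarith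
  have hZ0 : 0 < Z := by norm_num at *; linarith
  have hXZ : X = π ^ 2 / Z := by
    rw [hZdef]; field_simp
  have hE := exp_pos (-Z)
  have hEs : exp (-Z) ≤ 0.00559 :=
    exp_neg_div_le (p := 83) (q := 16) (by norm_num) (by norm_num) (by norm_num)
      (by norm_num at *; linarith)
  have hε : exp (-Z) ^ 3 ≤ 0.00559 ^ 3 := by gcongr
  have key := mul_sub_mul_exp_neg_le hZ
  have hZ1 : 1.9 ≤ Z := by norm_num at *; linarith
  obtain ⟨d1, p1, -, e1⟩ := gaussRel_eq (k := 1) (by norm_num) hZ1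
    (exp_neg_pow_five_le (X := Z) (by norm_num at *; linarith))
  obtain ⟨d2, p2, q2, e2⟩ := gaussRel_eq (k := 2) (by norm_num) hZ1
    (exp_neg_pow_five_le (X := Z) (by norm_num at *; linarith))
  have hε0 : 0 < exp (-Z) ^ 3 := by positivity
  have h1 : 1 ≤ gaussRel 1 Z := by rw [e1]; norm_num; linarith
  have h2 : gaussRel 2 Z ≤ 1.00001 := by rw [e2]; norm_num at *; linarith
  have h0 : 1 ≤ gaussMoment 0 Z := by
    rw [gaussMoment_zero]; linarith [gaussTail_pos 0 hZ0]
  rw [bump, hXZ, bumpNum_inv hZ0]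
  refine div_nonpos_of_nonpos_of_nonneg (mul_nonpos_of_nonneg_of_nonpos (by positivity) ?_)
    (gaussMoment_pos 0 (by positivity)).le
  rw [gaussMoment_succ, gaussMoment_succ, gaussTail_eq_gaussRel, gaussTail_eq_gaussRel]
  have g1 : Z ^ 2 * (2 * (exp (-Z) * gaussRel 2 Z)) ≤ Z ^ 2 * (2 * (exp (-Z) * 1.00001)) := by
    gcongr
  have g2 : Z * (2 * (exp (-Z) * 1)) ≤ Z * (2 * (exp (-Z) * gaussRel 1 Z)) := by gcongr
  norm_num at *
  linarith

theorem bump_eq (X : ℝ) : bump X = 2 * X * exp (-X) * bumpCore X / gaussMoment 0 X := by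
  rw [bump, bumpNum_eq_bumpCore]

theorem bump_lt_of_far : bump 5.5 < bump 2.5 := by
  have a1 : 0.08208 ≤ exp (-2.5) :=
    le_exp_neg_div (p := 5) (q := 2) (by norm_num) (by norm_num) (by norm_num) (by norm_num)
  have a2 : exp (-2.5) ≤ 0.0821 :=
    exp_neg_div_le (p := 5) (q := 2) (by norm_num) (by norm_num) (by norm_num) (by norm_num)
  have b2 : exp (-5.5) ≤ 0.0041 :=
    exp_neg_div_le (p := 11) (q := 2) (by norm_num) (by norm_num) (by norm_num) (by norm_num)
  have hn := bumpCore_ge (X := 2.5) (by norm_num)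
  have hn' := bumpCore_le (X := 5.5) (by norm_num) (by norm_num)
  obtain ⟨-, s⟩ := gaussMoment_zero_bounds (X := 2.5) (by norm_num)
  have ε2 : exp (-2.5) ^ 3 ≤ 0.0821 ^ 3 := by gcongr
  have ε5 : exp (-5.5) ^ 3 ≤ 0.0041 ^ 3 := by gcongr
  have s5 : 1 ≤ gaussMoment 0 5.5 := by
    rw [gaussMoment_zero]; linarith [gaussTail_pos 0 (show (0 : ℝ) < 5.5 by norm_num)]
  have s2 : gaussMoment 0 2.5 ≤ 1.166 := by
    refine s.trans ?_
    calc 1 + 2 * exp (-2.5) * (1 + 1.00001 * exp (-2.5) ^ 3)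
        ≤ 1 + 2 * 0.0821 * (1 + 1.00001 * 0.0821 ^ 3) := by gcongr
      _ ≤ 1.166 := by norm_num
  have h5 : bump 5.5 ≤ 0.17 := by
    rw [bump_eq, div_le_iff₀ (by linarith)]
    have : bumpCore 5.5 ≤ 3.51 := by norm_num at *; linarith
    have hc := bumpCore_pos (X := 5.5) (by norm_num)
    calc 2 * 5.5 * exp (-5.5) * bumpCore 5.5 ≤ 2 * 5.5 * 0.0041 * 3.51 := by gcongr
      _ ≤ 0.17 * 1 := by norm_num
      _ ≤ 0.17 * gaussMoment 0 5.5 := by gcongr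
  have h2 : 0.175 ≤ bump 2.5 := by
    rw [bump_eq, le_div_iff₀ (gaussMoment_pos 0 (by norm_num))]
    calc 0.175 * gaussMoment 0 2.5 ≤ 0.175 * 1.166 := by gcongr
      _ ≤ 2 * 2.5 * 0.08208 * 0.5 := by norm_num
      _ ≤ 2 * 2.5 * exp (-2.5) * bumpCore 2.5 := by
          gcongr; norm_num at *; linarith
  norm_num at *
  linarith

/-- The part of `bump₁` coming from the derivative of the numerator. -/
noncomputable def bumpSlope (X : ℝ) : ℝ :=
  -X ^ 2 * gaussRel 3 X + 4 * X * gaussRel 2 X - 2 * gaussRel 1 X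

theorem bump₁_eq_bumpSlope (X : ℝ) : bump₁ X = 2 * X * exp (-X) *
    (bumpSlope X * gaussMoment 0 X + bumpCore X * (X * gaussMoment 1 X)) /
      gaussMoment 0 X ^ 2 := by
  rw [bump₁, bumpNum_eq_bumpCore, bumpSlope]
  simp only [gaussMoment_succ, gaussTail_eq_gaussRel]
  ring

theorem exp_neg_pow_five_le' {X : ℝ} (hX : 1.9 ≤ X) : exp (-X) ^ 5 ≤ 0.00008 := by
  have h : exp (-X) ≤ 0.1496 :=
    exp_neg_div_le (p := 19) (q := 10) (by norm_num) (by norm_num) (by norm_num)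
      (by norm_num at hX ⊢; linarith)
  calc exp (-X) ^ 5 ≤ 0.1496 ^ 5 := by gcongr
    _ ≤ 0.00008 := by norm_num

theorem bumpSlope_ge {X : ℝ} (hX : 1.9 ≤ X) (hX' : X ≤ 2.5) :
    -X ^ 2 + 4 * X - 2 - exp (-X) ^ 3 * (64 * X ^ 2 - 64 * X + 8.8) ≤ bumpSlope X := by
  obtain ⟨d1, -, q1, e1⟩ := gaussRel_eq (k := 1) (by norm_num) hX (exp_neg_pow_five_le' hX)
  obtain ⟨d2, p2, -, e2⟩ := gaussRel_eq (k := 2) (by norm_num) hX (exp_neg_pow_five_le' hX)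
  obtain ⟨d3, p3, q3, e3⟩ := gaussRel_eq (k := 3) (by norm_num) hX (exp_neg_pow_five_le' hX)
  have hXp : 0 ≤ X := by norm_num at hX; linarith
  have hε : 0 < exp (-X) ^ 3 := by positivity
  rw [bumpSlope, e1, e2, e3]
  set ε := exp (-X) ^ 3
  have g2 : X ^ 2 * d3 ≤ 2.5 ^ 2 * d3 := by gcongr
  have g3 := mul_nonneg hXp p2
  norm_num at *
  linarith

/-- Below X = 2 the core may be slightly negative, but it is at least -0.1 and its cofactor is at
most 0.64. -/
theorem bumpCore_mul_ge {X : ℝ} (hX : 1.9 ≤ X) :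
    -0.08 ≤ bumpCore X * (X * gaussMoment 1 X) := by
  have hXp : 0 < X := by norm_num at hX; linarith
  have hS1p := gaussMoment_pos 1 hXp
  rcases le_total 2 X with h | h
  · have := bumpCore_pos h
    have : 0 ≤ bumpCore X * (X * gaussMoment 1 X) := by positivity
    norm_num at *; linarith
  obtain ⟨d1, p1, q1, e1⟩ := gaussRel_eq (k := 1) (by norm_num) hX (exp_neg_pow_five_le' hX)
  obtain ⟨d2, p2, -, e2⟩ := gaussRel_eq (k := 2) (by norm_num) hX (exp_neg_pow_five_le' hX)
  have hE : exp (-X) ≤ 0.1496 :=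
    exp_neg_div_le (p := 19) (q := 10) (by norm_num) (by norm_num) (by norm_num)
      (by norm_num at hX ⊢; linarith)
  have hε : exp (-X) ^ 3 ≤ 0.1496 ^ 3 := by gcongr
  have hε0 : 0 < exp (-X) ^ 3 := by positivity
  have hS1 : gaussMoment 1 X ≤ 0.32 := by
    rw [gaussMoment_succ, gaussTail_eq_gaussRel]
    have h1 : gaussRel 1 X ≤ 1.02 := by rw [e1]; norm_num at *; linarith
    have h0 : 0 ≤ gaussRel (0 + 1) X := (gaussRel_pos _ hXp).le
    calc 2 * (exp (-X) * gaussRel (0 + 1) X) ≤ 2 * (0.1496 * 1.02) := by gcongr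
      _ ≤ 0.32 := by norm_num
  have hb : -0.1 ≤ bumpCore X := by
    rw [bumpCore, e1, e2]
    norm_num at *
    nlinarith [mul_nonneg hXp.le p2, mul_nonneg hε0.le (sub_nonneg.2 hX)]
  have hu : X * gaussMoment 1 X ≤ 2 * 0.32 := by gcongr
  have hp : 0 ≤ X * gaussMoment 1 X := by positivity
  have := mul_le_mul_of_nonneg_right hb hp
  norm_num at *; linarith

theorem gaussMoment_zero_le {X : ℝ} (hX : 1.9 ≤ X) : gaussMoment 0 X ≤ 1 + 2.02 * exp (-X) := by
  obtain ⟨d0, p0, q0, e0⟩ := gaussRel_eq (k := 0) (by norm_num) hX (exp_neg_pow_five_le' hX)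
  have hE : exp (-X) ≤ 0.1496 :=
    exp_neg_div_le (p := 19) (q := 10) (by norm_num) (by norm_num) (by norm_num)
      (by norm_num at hX ⊢; linarith)
  have hε : exp (-X) ^ 3 ≤ 0.1496 ^ 3 := by gcongr
  have h1 : gaussRel 0 X ≤ 1.01 := by rw [e0]; norm_num at *; linarith
  rw [gaussMoment_zero, gaussTail_eq_gaussRel]
  have := mul_le_mul_of_nonneg_left h1 (exp_pos (-X)).le
  norm_num at *
  linarith

/-- Here κ is what remains of k after the ε correction of `bumpSlope` and the loss 0.08 from
`bumpCore_mul_ge`. Then `bump₁` is at least 2X exp(-X) κ / S₀, and S₀ ≤ 1 + 2.02 exp(-X) produces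
the constant 1.01. -/
theorem bump₁_ge_of_bounds {X x₀ x₁ E₀ E₁ k κ : ℝ} (hx₀ : 1.9 ≤ x₀) (hx₁ : x₁ ≤ 2.5)
    (h₀ : x₀ ≤ X) (h₁ : X ≤ x₁) (hE₀ : E₀ ≤ exp (-X)) (hE₁ : exp (-X) ≤ E₁)
    (hκ : κ ≤ k - E₁ ^ 3 * (64 * x₁ ^ 2 - 64 * x₁ + 8.8) - 0.08) (hκ0 : 0 ≤ κ)
    (hpos : 0 ≤ 2 * x₀ * κ - 1.01)
    (hfin : 0.5 ≤ E₀ * (2 * x₀ * κ - 1.01))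
    (hk : k ≤ -X ^ 2 + 4 * X - 2) :
    0.5 ≤ bump₁ X := by
  have hX : 1.9 ≤ X := hx₀.trans h₀
  have hX' : X ≤ 2.5 := h₁.trans hx₁
  have hXp : 0 < X := by norm_num at hX; linarith
  have hE := exp_pos (-X)
  have hε : exp (-X) ^ 3 ≤ E₁ ^ 3 := by gcongr
  have hE₁0 : 0 ≤ E₁ := hE.le.trans hE₁
  have hS0 : 1 ≤ gaussMoment 0 X := by
    rw [gaussMoment_zero]; linarith [gaussTail_pos 0 hXp]
  have hS0' := gaussMoment_zero_le hX
  have hcore := bumpCore_mul_ge hX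
  have hslope : κ + 0.08 ≤ bumpSlope X := by
    have g1 : exp (-X) ^ 3 * (64 * X ^ 2 - 64 * X + 8.8) ≤
        E₁ ^ 3 * (64 * x₁ ^ 2 - 64 * x₁ + 8.8) := by
      norm_num at hX ⊢
      refine mul_le_mul hε (by nlinarith) (by nlinarith) (by positivity)
    linarith [bumpSlope_ge hX hX']
  have hmain : κ * gaussMoment 0 X ≤
      bumpSlope X * gaussMoment 0 X + bumpCore X * (X * gaussMoment 1 X) := by
    have := mul_le_mul_of_nonneg_right hslope (show 0 ≤ gaussMoment 0 X by linarith)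
    norm_num at this hcore
    linarith
  have hfin' : 0.5 * gaussMoment 0 X ≤ 2 * X * exp (-X) * κ := by
    have k1 : 0.5 ≤ exp (-X) * (2 * x₀ * κ - 1.01) := hfin.trans (by gcongr)
    have k2 : 2 * x₀ * exp (-X) * κ ≤ 2 * X * exp (-X) * κ := by gcongr
    norm_num at k1 k2 hS0' ⊢
    linarith
  rw [bump₁_eq_bumpSlope, le_div_iff₀ (by positivity)]
  calc 0.5 * gaussMoment 0 X ^ 2 = 0.5 * gaussMoment 0 X * gaussMoment 0 X := by ring
    _ ≤ 2 * X * exp (-X) * κ * gaussMoment 0 X := by gcongr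
    _ = 2 * X * exp (-X) * (κ * gaussMoment 0 X) := by ring
    _ ≤ _ := by gcongr

/-- With `neg_half_lt_bump₁` this says that bump rises faster on the left flank than it ever falls
beyond the mode, which is the slope condition of `reflection_sign_change`. -/
theorem half_le_bump₁ {X : ℝ} (h₀ : 1.9 ≤ X) (h₁ : X ≤ 2.5) : 0.5 ≤ bump₁ X := by
  rcases le_total X 2.05 with h | h
  · refine bump₁_ge_of_bounds (x₀ := 1.9) (x₁ := 2.05) (E₀ := 0.1287) (E₁ := 0.1496) (k := 1.98)
      (κ := 1.4) (by norm_num) (by norm_num) h₀ h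
      (le_exp_neg_div (p := 41) (q := 20) (by norm_num) (by norm_num) (by norm_num)
        (by norm_num at h ⊢; linarith))
      (exp_neg_div_le (p := 19) (q := 10) (by norm_num) (by norm_num) (by norm_num)
        (by norm_num at h₀ ⊢; linarith)) (by norm_num) (by norm_num) (by norm_num)
      (by norm_num) ?_
    norm_num at *
    nlinarith
  rcases le_total X 2.2 with h' | h'
  · refine bump₁_ge_of_bounds (x₀ := 2.05) (x₁ := 2.2) (E₀ := 0.1108) (E₁ := 0.1288) (k := 1.959)
      (κ := 1.49) (by norm_num) (by norm_num) h h'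
      (le_exp_neg_div (p := 11) (q := 5) (by norm_num) (by norm_num) (by norm_num)
        (by norm_num at h' ⊢; linarith))
      (exp_neg_div_le (p := 41) (q := 20) (by norm_num) (by norm_num) (by norm_num)
        (by norm_num at h ⊢; linarith)) (by norm_num) (by norm_num) (by norm_num)
      (by norm_num) ?_
    norm_num at *
    nlinarith
  rcases le_total X 2.35 with h'' | h''
  · refine bump₁_ge_of_bounds (x₀ := 2.2) (x₁ := 2.35) (E₀ := 0.0953) (E₁ := 0.1109) (k := 1.877)
      (κ := 1.5) (by norm_num) (by norm_num) h' h''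
      (le_exp_neg_div (p := 47) (q := 20) (by norm_num) (by norm_num) (by norm_num)
        (by norm_num at h'' ⊢; linarith))
      (exp_neg_div_le (p := 11) (q := 5) (by norm_num) (by norm_num) (by norm_num)
        (by norm_num at h' ⊢; linarith)) (by norm_num) (by norm_num) (by norm_num)
      (by norm_num) ?_
    norm_num at *
    nlinarith
  rcases le_total X 2.43 with h3 | h3
  · refine bump₁_ge_of_bounds (x₀ := 2.35) (x₁ := 2.43) (E₀ := 0.088) (E₁ := 0.0954) (k := 1.81)
      (κ := 1.5) (by norm_num) (by norm_num) h'' h3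
      (le_exp_neg_div (p := 243) (q := 100) (by norm_num) (by norm_num) (by norm_num)
        (by norm_num at h3 ⊢; linarith))
      (exp_neg_div_le (p := 47) (q := 20) (by norm_num) (by norm_num) (by norm_num)
        (by norm_num at h'' ⊢; linarith)) (by norm_num) (by norm_num) (by norm_num)
      (by norm_num) ?_
    norm_num at *
    nlinarith
  · refine bump₁_ge_of_bounds (x₀ := 2.43) (x₁ := 2.5) (E₀ := 0.08208) (E₁ := 0.0881) (k := 1.75)
      (κ := 1.49) (by norm_num) (by norm_num) h3 h₁
      (le_exp_neg_div (p := 5) (q := 2) (by norm_num) (by norm_num) (by norm_num)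
        (by norm_num at h₁ ⊢; linarith))
      (exp_neg_div_le (p := 243) (q := 100) (by norm_num) (by norm_num) (by norm_num)
        (by norm_num at h3 ⊢; linarith)) (by norm_num) (by norm_num) (by norm_num)
      (by norm_num) ?_
    norm_num at *
    nlinarith

theorem quartic_le_exp {h : ℝ} (hh : 0 ≤ h) :
    1 + h + h ^ 2 / 2 + h ^ 3 / 6 + h ^ 4 / 24 ≤ exp h := by
  have := Real.sum_le_exp_of_nonneg hh 5
  simp only [Finset.sum_range_succ, Finset.sum_range_zero] at this
  norm_num [Nat.factorial] at this
  linarith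

theorem cubic_mul_exp_neg_le {X : ℝ} (hX : 3.5 ≤ X) :
    2 * (X ^ 3 - 4 * X ^ 2 + 2 * X) * exp (-X) ≤ 0.485 := by
  rcases le_total X 4 with h | h
  · have h1 : exp (-X) ≤ 0.0302 :=
      exp_neg_div_le (p := 7) (q := 2) (by norm_num) (by norm_num) (by norm_num)
        (by norm_num at hX ⊢; linarith)
    have h2 : 2 * (X ^ 3 - 4 * X ^ 2 + 2 * X) ≤ 16 := by
      norm_num at hX
      nlinarith [mul_nonneg (sub_nonneg.2 h) (sub_nonneg.2 hX), sq_nonneg X]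
    calc _ ≤ 16 * exp (-X) := by gcongr
      _ ≤ 16 * 0.0302 := by gcongr
      _ ≤ _ := by norm_num
  · have h1 : exp (-4) ≤ 0.01832 :=
      exp_neg_div_le (p := 4) (q := 1) (by norm_num) (by norm_num) (by norm_num) (by norm_num)
    obtain ⟨u, rfl⟩ : ∃ u, X = 4 + u := ⟨X - 4, by ring⟩
    have hu : 0 ≤ u := by linarith
    have h2 := quartic_le_exp hu
    have h3 : 2 * ((4 + u) ^ 3 - 4 * (4 + u) ^ 2 + 2 * (4 + u)) ≤ 26.47 * exp u := by
      refine le_trans ?_ (mul_le_mul_of_nonneg_left h2 (by norm_num))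
      norm_num
      -- The quotient of the cubic by exp u is largest near u = 1.1, so the hints are squares
      -- vanishing there.
      nlinarith [mul_nonneg hu (sq_nonneg (u - 1.1)), sq_nonneg (u ^ 2 - 1.21), sq_nonneg (u - 1.1)]
    calc _ ≤ 26.47 * exp u * exp (-(4 + u)) := by gcongr
      _ = 26.47 * exp (-4) := by rw [mul_assoc, ← Real.exp_add]; ring_nf
      _ ≤ 26.47 * 0.01832 := by gcongr
      _ ≤ _ := by norm_num

/-- The main term -2X exp(-X)(X² - 4X + 2) is at least -0.485 and the correction at least -0.01. The
core term is positive, and division by S₀ ≥ 1 only helps. -/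
theorem neg_half_lt_bump₁ {X : ℝ} (hX : 3.5 ≤ X) : -0.5 < bump₁ X := by
  have hXp : 0 < X := by norm_num at *; linarith
  have hX2 : 2.5 ≤ X := by norm_num at *; linarith
  have hX1 : 1.9 ≤ X := by norm_num at *; linarith
  have hE := exp_pos (-X)
  have hEs : exp (-X) ≤ 0.0302 :=
    exp_neg_div_le (p := 7) (q := 2) (by norm_num) (by norm_num) (by norm_num)
      (by norm_num at hX ⊢; linarith)
  obtain ⟨d1, p1, q1, e1⟩ := gaussRel_eq (k := 1) (by norm_num) hX1 (exp_neg_pow_five_le hX2)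
  obtain ⟨d2, p2, q2, e2⟩ := gaussRel_eq (k := 2) (by norm_num) hX1 (exp_neg_pow_five_le hX2)
  obtain ⟨d3, p3, q3, e3⟩ := gaussRel_eq (k := 3) (by norm_num) hX1 (exp_neg_pow_five_le hX2)
  have hε0 : 0 < exp (-X) ^ 3 := by positivity
  have hS0 : 1 ≤ gaussMoment 0 X := by
    rw [gaussMoment_zero]; linarith [gaussTail_pos 0 hXp]
  have hcore := bumpCore_pos (X := X) (by norm_num at *; linarith)
  have hS1 := gaussMoment_pos 1 hXp
  have hslope : -(X ^ 2 - 4 * X + 2) - 65 * X ^ 2 * exp (-X) ^ 3 ≤ bumpSlope X := by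
    have g := mul_le_mul_of_nonneg_left q3 (sq_nonneg X)
    have g3 := mul_nonneg hXp.le p2
    have g4 : 0 ≤ exp (-X) ^ 3 * (X - 3.5) * X :=
      mul_nonneg (mul_nonneg hε0.le (sub_nonneg.2 hX)) hXp.le
    have g5 : 0 ≤ exp (-X) ^ 3 * (X - 3.5) := mul_nonneg hε0.le (sub_nonneg.2 hX)
    rw [bumpSlope, e1, e2, e3]
    norm_num at *
    nlinarith
  have hXE := mul_exp_neg_le hX
  have htail : 130 * (X * exp (-X)) ^ 3 * exp (-X) ≤ 0.01 := by
    calc 130 * (X * exp (-X)) ^ 3 * exp (-X) ≤ 130 * 0.1058 ^ 3 * 0.0302 := by gcongr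
      _ ≤ 0.01 := by norm_num
  have hmain := cubic_mul_exp_neg_le hX
  have hlow : -0.495 ≤ 2 * X * exp (-X) * bumpSlope X := by
    have := mul_le_mul_of_nonneg_left hslope (show 0 ≤ 2 * X * exp (-X) by positivity)
    have e : 2 * X * exp (-X) * (-(X ^ 2 - 4 * X + 2) - 65 * X ^ 2 * exp (-X) ^ 3) =
        -(2 * (X ^ 3 - 4 * X ^ 2 + 2 * X) * exp (-X)) -
          130 * (X * exp (-X)) ^ 3 * exp (-X) := by ring
    rw [e] at this
    norm_num at *
    linarith
  rw [bump₁_eq_bumpSlope, lt_div_iff₀ (by positivity)]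
  have h1 := mul_le_mul_of_nonneg_right hlow (show 0 ≤ gaussMoment 0 X by linarith)
  have h2 : 0 ≤ 2 * X * exp (-X) * (bumpCore X * (X * gaussMoment 1 X)) := by positivity
  have h3 : gaussMoment 0 X ≤ gaussMoment 0 X ^ 2 := by nlinarith
  norm_num at *
  nlinarith

/-! ### The mode and the sign changes of the reflected difference -/

theorem logBump₂_strictMonoOn : StrictMonoOn logBump₂ (Icc 2.5 3.75) := by
  have hd : ∀ X ∈ Icc (2.5 : ℝ) 3.75, HasDerivAt logBump₂ (logBump₃ X / X) X := fun X hX =>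
    hasDerivAt_logBump₂ (by have := hX.1; norm_num at this; linarith)
  refine strictMonoOn_of_deriv_pos (convex_Icc _ _)
    (fun X hX => (hd X hX).continuousAt.continuousWithinAt) fun X hX => ?_
  have hX' := interior_subset hX
  rw [(hd X hX').deriv]
  have := hX'.1
  norm_num at this
  exact div_pos (logBump₃_pos hX'.1 hX'.2) (by linarith)

theorem logBump₂_neg {X : ℝ} (h₀ : 2.5 ≤ X) (h₁ : X ≤ 3.54) : logBump₂ X ≤ -6.81 :=
  (logBump₂_strictMonoOn.monotoneOn ⟨h₀, h₁.trans (by norm_num)⟩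
    ⟨by norm_num, by norm_num⟩ h₁).trans logBump₂_le

theorem logBump₁_strictAntiOn : StrictAntiOn logBump₁ (Icc 2.5 3.54) := by
  have hd : ∀ X ∈ Icc (2.5 : ℝ) 3.54, HasDerivAt logBump₁ (logBump₂ X / X) X := fun X hX =>
    hasDerivAt_logBump₁ (by have := hX.1; norm_num at this; linarith)
  refine strictAntiOn_of_deriv_neg (convex_Icc _ _)
    (fun X hX => (hd X hX).continuousAt.continuousWithinAt) fun X hX => ?_
  have hX' := interior_subset hX
  rw [(hd X hX').deriv]
  have h := hX'.1
  have h2 := logBump₂_neg hX'.1 hX'.2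
  norm_num at h h2
  exact div_neg_of_neg_of_pos (by linarith) (by linarith)

/-- The mode of `bump`. -/
theorem exists_logBump₁_eq_zero :
    ∃ m, π / 0.894705 < m ∧ m < π / 0.894704 ∧ logBump₁ m = 0 := by
  have hp := Real.pi_gt_d4
  have hlt : π / 0.894705 ≤ π / 0.894704 := by
    have := Real.pi_pos
    gcongr
    norm_num
  have h1 : 2 ≤ π / 0.894705 := by
    rw [le_div_iff₀ (by norm_num)]; norm_num at *; linarith
  have hc : ContinuousOn logBump₁ (Icc (π / 0.894705) (π / 0.894704)) := fun X hX =>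
    (hasDerivAt_logBump₁ (h1.trans hX.1)).continuousAt.continuousWithinAt
  obtain ⟨m, hm, h0⟩ := intermediate_value_Ioo' hlt hc ⟨logBump₁_neg_right, logBump₁_pos_left⟩
  exact ⟨m, hm.1, hm.2, h0⟩

theorem logBump₁_pos_of_lt {m X : ℝ} (hm : m ≤ 3.54) (hm0 : logBump₁ m = 0) (h₀ : 2.5 ≤ X)
    (h : X < m) : 0 < logBump₁ X := by
  rw [← hm0]
  exact logBump₁_strictAntiOn ⟨h₀, h.le.trans hm⟩ ⟨h₀.trans h.le, hm⟩ h

theorem logBump₁_neg_of_gt {m X : ℝ} (hm : 2.5 ≤ m) (hm0 : logBump₁ m = 0) (h : m < X) :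
    logBump₁ X < 0 := by
  rcases le_total X 3.54 with h' | h'
  · rw [← hm0]
    exact logBump₁_strictAntiOn ⟨hm, h.le.trans h'⟩ ⟨hm.trans h.le, h'⟩ h
  · exact logBump₁_neg_of_ge h'

/-- The sign changes of `bump (π e^(τ+s)) - bump (π e^(τ-s))`, for `m` the mode of `bump`. -/
theorem bump_sign_change {m : ℝ} (hm : 3.5 ≤ m) (hm' : m ≤ 3.54) (hm0 : logBump₁ m = 0)
    {τ : ℝ} (hτ : 0 ≤ τ) :
    ∃ s₀, 0 ≤ s₀ ∧ (τ ≤ log (m / π) → s₀ = 0) ∧ (log (m / π) < τ → 0 < s₀) ∧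
      (∀ s, 0 < s → s < s₀ → bump (π * exp (τ + s)) < bump (π * exp (τ - s))) ∧
      ∀ s, s₀ < s → bump (π * exp (τ - s)) < bump (π * exp (τ + s)) := by
  have hpi := Real.pi_pos
  have hpi2 := Real.pi_lt_d4
  have hpi3 := Real.pi_gt_d4
  have hle : ∀ {x t : ℝ}, 0 < x → (log (x / π) ≤ t ↔ x ≤ π * exp t) := fun {x t} hx => by
    rw [Real.log_le_iff_le_exp (by positivity), div_le_iff₀ hpi, mul_comm]
  have hge : ∀ {x t : ℝ}, 0 < x → (t ≤ log (x / π) ↔ π * exp t ≤ x) := fun {x t} hx => by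
    rw [Real.le_log_iff_exp_le (by positivity), le_div_iff₀ hpi, mul_comm]
  have hlt : ∀ {x t : ℝ}, 0 < x → (log (x / π) < t ↔ x < π * exp t) := fun {x t} hx => by
    rw [Real.log_lt_iff_lt_exp (by positivity), div_lt_iff₀ hpi, mul_comm]
  have hgt : ∀ {x t : ℝ}, 0 < x → (t < log (x / π) ↔ π * exp t < x) := fun {x t} hx => by
    rw [Real.lt_log_iff_exp_lt (by positivity), lt_div_iff₀ hpi, mul_comm]
  have hmpos : 0 < m := by norm_num at hm; linarith
  have hval : ∀ {x : ℝ}, 0 < x → π * exp (log (x / π)) = x := fun {x} hx => by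
    rw [Real.exp_log (by positivity)]; field_simp
  have hpos : ∀ t, 0 < π * exp t := fun t => by positivity
  have hW : ∀ t, HasDerivAt (fun t => bump (π * exp t)) (bump₁ (π * exp t)) t := fun t =>
    hasDerivAt_comp_pi_mul_exp (hasDerivAt_bump (hpos t))
  have hc2 : ∀ {t : ℝ}, log (2.5 / π) ≤ t → 2 ≤ π * exp t := fun {t} ht => by
    rw [hle (by norm_num)] at ht
    norm_num at ht; linarith
  have h2 : ∀ {X : ℝ}, (2.5 : ℝ) ≤ X → 2 ≤ X := fun {X} h => by norm_num at h; linarith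
  have hlog : ∀ {x y : ℝ}, 0 < x → x < y → log (x / π) < log (y / π) := fun {x y} hx hxy =>
    Real.log_lt_log (by positivity) (by gcongr)
  -- In the variable X = π e^t the points e, c, r are 1.9, 2.5, 5.5, and V is log W, defined from c
  -- on because bump is positive for X ≥ 2.
  refine reflection_sign_change (W := fun t => bump (π * exp t)) (W₁ := fun t => bump₁ (π * exp t))
    (V := fun t => log (bump (π * exp t))) (V₁ := fun t => logBump₁ (π * exp t))
    (V₂ := fun t => logBump₂ (π * exp t)) (e := log (1.9 / π)) (c := log (2.5 / π))
    (r := log (5.5 / π)) (hlog (by norm_num) (by norm_num))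
    (hlog (by norm_num) (lt_of_lt_of_le (by norm_num) hm))
    (hlog hmpos (lt_of_le_of_lt hm' (by norm_num))) ?_ hW ?_ ?_ ?_ ?_ ?_ ?_ ?_ ?_ ?_ ?_ ?_ hτ
  · refine Real.log_nonneg ?_
    rw [le_div_iff₀ hpi]
    norm_num at hm hpi2; linarith
  · intro t ht
    exact bump_nonpos (hpos t) ((hge (by norm_num)).1 ht)
  · intro t ht
    have : 1 ≤ exp t := Real.one_le_exp ht
    refine bump_pos ?_
    norm_num at hpi3
    nlinarith
  · refine strictMonoOn_of_deriv_pos (convex_Icc _ _)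
      (fun t _ => (hW t).continuousAt.continuousWithinAt) fun t ht => ?_
    rw [interior_Icc] at ht
    rw [(hW t).deriv]
    have h1 := (hlt (by norm_num)).1 ht.1
    have h3 := (hgt hmpos).1 ht.2
    rcases le_total (π * exp t) 2.5 with h | h
    · have := half_le_bump₁ h1.le h
      norm_num at this; linarith
    · rw [bump₁_eq (h2 h)]
      exact mul_pos (bump_pos (h2 h)) (logBump₁_pos_of_lt hm' hm0 h h3)
  · refine strictAntiOn_of_deriv_neg (convex_Ici _)
      (fun t _ => (hW t).continuousAt.continuousWithinAt) fun t ht => ?_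
    rw [interior_Ici] at ht
    rw [(hW t).deriv]
    have h1 := (hlt hmpos).1 ht
    have hX : 2 ≤ π * exp t := by norm_num at hm; linarith
    rw [bump₁_eq hX]
    exact mul_neg_of_pos_of_neg (bump_pos hX)
      (logBump₁_neg_of_gt (le_trans (by norm_num) hm) hm0 h1)
  · rw [hval (by norm_num), hval (by norm_num)]
    exact bump_lt_of_far
  · intro q hq p hp
    have h1 := (hle (by norm_num)).1 hq.1
    have h3 := (hge (by norm_num)).1 hq.2
    have h4 := (hle hmpos).1 hp
    have h5 := half_le_bump₁ h1 h3
    have h6 := neg_half_lt_bump₁ (hm.trans h4)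
    norm_num at h5 h6
    linarith
  · intro p q hp hq
    exact (Real.log_lt_log_iff (bump_pos (hc2 hp)) (bump_pos (hc2 hq))).symm
  · intro t ht
    exact hasDerivAt_comp_pi_mul_exp (f := fun X => log (bump X)) (hasDerivAt_log_bump (hc2 ht))
  · intro t ht
    exact hasDerivAt_comp_pi_mul_exp (hasDerivAt_logBump₁ (hc2 ht))
  · rw [hval hmpos, hm0]
  · intro q p hq hqm hmp hpr hqp
    have h1 := (hle (by norm_num)).1 hq
    have h3 := (hge hmpos).1 hqm
    have h4 := (hle hmpos).1 hmp
    have h5 := (hge (by norm_num)).1 hpr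
    have h6 : π * exp q < π * exp p := by gcongr
    -- Up to 3.75 monotonicity compares the two points; beyond, the gap between -6.81 and -6.8 does.
    rcases le_total (π * exp p) 3.75 with h | h
    · exact logBump₂_strictMonoOn ⟨h1, h6.le.trans h⟩ ⟨h1.trans h6.le, h⟩ h6
    · have h7 := logBump₂_neg h1 (h3.trans hm')
      have h8 := logBump₂_ge h h5
      norm_num at h7 h8
      linarith

/-! ### The threshold equation and the main theorem -/

theorem logBump₁_eq_zero_iff {m X : ℝ} (hm : 2.5 ≤ m) (hm' : m ≤ 3.54) (hm0 : logBump₁ m = 0)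
    (hX : 2.5 ≤ X) : logBump₁ X = 0 ↔ X = m := by
  constructor
  · intro h
    rcases lt_trichotomy X m with h1 | h1 | h1
    · exact absurd h (logBump₁_pos_of_lt hm' hm0 hX h1).ne'
    · exact h1
    · exact absurd h (logBump₁_neg_of_gt hm hm0 h1).ne
  · rintro rfl
    exact hm0

/-- Up to sign the left side is ∂²/∂y² of θ - πaM at i. Along y = e^s the first derivative is S₀S₀
times a difference of bump values that vanishes at s = 0, so only the slopes of bump survive in the
second. -/
theorem two_mul_thresholdNum_sub {a : ℝ} (ha : 0 < a) :
    π * a * (2 * thresholdNum a - π * a * thresholdDen a) =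
      -2 * (bump₁ (π * a) * gaussMoment 0 (π * a) ^ 2) := by
  have h0 := (gaussMoment_pos 0 (show 0 < π * a by positivity)).ne'
  rw [thresholdNum_eq ha, thresholdDen_eq ha, bump₁, bumpNum]
  field_simp
  ring

theorem threshold_iff {a : ℝ} (ha : 1 ≤ a) :
    2 * thresholdNum a = π * a * thresholdDen a ↔ logBump₁ (π * a) = 0 := by
  have hpi := Real.pi_gt_d2
  norm_num at hpi
  have hX : 2 ≤ π * a := by nlinarith
  have ha0 : 0 < a := by linarith
  have h := two_mul_thresholdNum_sub ha0
  have h0 := (gaussMoment_pos 0 (show 0 < π * a by positivity)).ne'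
  have h1 := (bump_pos hX).ne'
  rw [bump₁_eq hX] at h
  have hpa : π * a ≠ 0 := by positivity
  constructor
  · intro he
    rw [he, sub_self, mul_zero] at h
    have h' : bump (π * a) * logBump₁ (π * a) * gaussMoment 0 (π * a) ^ 2 = 0 := by linarith
    simpa [h0, h1] using h'
  · intro he
    rw [he, mul_zero, zero_mul, mul_zero] at h
    have := (mul_eq_zero.1 h).resolve_left hpa
    linarith

/-- Since S₃ ≥ S₂, the denominator is at most 2 S₂ ((2 - b) S₀ + b S₁) with b = πa, and S₁ is too
small to offset 2 - b ≤ -1.14. -/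
theorem thresholdDen_neg {a : ℝ} (ha : 1 ≤ a) (ha' : a ≤ 9 / 8) : thresholdDen a < 0 := by
  have hpi := Real.pi_gt_d2
  have hpi' := Real.pi_lt_d2
  norm_num at hpi hpi'
  have ha0 : 0 < a := by linarith
  rw [thresholdDen_eq ha0]
  obtain ⟨b, hb⟩ : ∃ b, b = π * a := ⟨_, rfl⟩
  rw [← hb]
  have hb1 : 3.14 ≤ b := by rw [hb]; norm_num; nlinarith
  have hb2 : b ≤ 3.55 := by rw [hb]; norm_num; nlinarith
  have hbX : 2.5 ≤ b := by norm_num at *; linarith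
  have hb0 : 0 < b := by norm_num at hb1; linarith
  have hE : exp (-b) ≤ 0.0434 :=
    exp_neg_div_le (p := 157) (q := 50) (by norm_num) (by norm_num) (by norm_num)
      (by norm_num at *; linarith)
  have hEp := exp_pos (-b)
  obtain ⟨-, h1⟩ := gaussMoment_one_bounds hbX
  have hS1 : gaussMoment 1 b ≤ 0.09 := by
    refine h1.trans ?_
    calc 2 * exp (-b) * (1 + 4.0001 * exp (-b) ^ 3)
        ≤ 2 * 0.0434 * (1 + 4.0001 * 0.0434 ^ 3) := by gcongr
      _ ≤ 0.09 := by norm_num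
  have hS0 : 1 ≤ gaussMoment 0 b := by
    rw [gaussMoment_zero]; linarith [gaussTail_pos 0 hb0]
  have hS2 := gaussMoment_pos 2 hb0
  have hS23 : gaussMoment 2 b ≤ gaussMoment 3 b := by
    rw [gaussMoment_succ, gaussMoment_succ]
    linarith [gaussTail_le_succ 2 hb0]
  have hS1p := gaussMoment_pos 1 hb0
  have k1 : b * (gaussMoment 2 b * gaussMoment 0 b) ≤ b * (gaussMoment 3 b * gaussMoment 0 b) := by
    gcongr
  have k2 : b * gaussMoment 1 b ≤ 3.55 * 0.09 := by gcongr
  have k3 : (2 - b) * gaussMoment 0 b + b * gaussMoment 1 b < 0 := by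
    have : (2 - b) * gaussMoment 0 b ≤ -1.14 := by norm_num at *; nlinarith
    norm_num at *
    linarith
  have k4 := mul_neg_of_pos_of_neg hS2 k3
  linarith

theorem theorem5p1 :
    ∃ α₁ : ℝ,
      (0.894704 ≤ α₁ ∧ α₁ < 0.894705) ∧
      -- `1 / α₁` is the unique solution of the threshold equation in `[1, 9/8]`
      1 / α₁ ∈ Set.Icc (1 : ℝ) (9 / 8) ∧
      (∀ a ∈ Set.Icc (1 : ℝ) (9 / 8),
        partialYY (latticeTheta a) Complex.I = Real.pi * a * partialYY (latticeM a) Complex.I ↔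
          a = 1 / α₁) ∧
      -- the same for the explicit form of the equation, whose denominator does not vanish
      (∀ a ∈ Set.Icc (1 : ℝ) (9 / 8),
        thresholdDen a ≠ 0 ∧
          (2 / (Real.pi * a) * (thresholdNum a / thresholdDen a) = 1 ↔ a = 1 / α₁)) ∧
      (∀ α ∈ Set.Icc α₁ 1, IsTheMinimizerOn (latticeM α) gammaA Complex.I) ∧
      (∀ α ∈ Set.Ioo 0 α₁, ∃ y : ℝ, 1 < y ∧
        IsTheMinimizerOn (latticeM α) gammaA ((y : ℂ) * Complex.I)) := by
  obtain ⟨m, hm1, hm2, hm0⟩ := exists_logBump₁_eq_zero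
  have hpi := Real.pi_pos
  have hpi3 := Real.pi_gt_d4
  have hpi4 := Real.pi_lt_d4
  rw [div_lt_iff₀ (by norm_num)] at hm1
  rw [lt_div_iff₀ (by norm_num)] at hm2
  have hm3 : 3.5 ≤ m := by norm_num at *; linarith
  have hm4 : m ≤ 3.54 := by norm_num at *; linarith
  have hm25 : 2.5 ≤ m := le_trans (by norm_num) hm3
  have hmpos : 0 < m := by norm_num at hm3; linarith
  have hthr : ∀ a ∈ Set.Icc (1 : ℝ) (9 / 8),
      (2 * thresholdNum a = π * a * thresholdDen a ↔ a = 1 / (π / m)) := by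
    intro a ha
    rw [threshold_iff ha.1, logBump₁_eq_zero_iff hm25 hm4 hm0
      (by have := ha.1; norm_num at *; nlinarith), one_div_div, eq_div_iff hpi.ne', mul_comm]
  have hmin : ∀ α, 0 < α → α ≤ 1 → ∃ s₀, 0 ≤ s₀ ∧ (π / m ≤ α → s₀ = 0) ∧ (α < π / m → 0 < s₀) ∧
      IsTheMinimizerOn (latticeM α) gammaA ((exp s₀ : ℝ) * Complex.I) := by
    intro α h0 h1
    -- The centre of reflection τ = log(1/α) is nonnegative because α ≤ 1; it is compared with
    -- log(m/π), and τ ≤ log(m/π) means α ≥ π/m.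
    have hτ : 0 ≤ log (1 / α) := Real.log_nonneg (by rw [le_div_iff₀ h0]; linarith)
    obtain ⟨s₀, hs, hzero, hpos, hneg, hpos'⟩ := bump_sign_change hm3 hm4 hm0 hτ
    have e : ∀ s, π * exp (log (1 / α) + s) = π / α * exp s := fun s => by
      rw [Real.exp_add, Real.exp_log (by positivity)]; field_simp
    have e' : ∀ s, π * exp (log (1 / α) - s) = π / α * exp (-s) := fun s => by
      rw [sub_eq_add_neg, e]
    refine ⟨s₀, hs, fun h => hzero ?_, fun h => hpos ?_,
      isTheMinimizerOn_of_bump h0 hs (fun s h1 h2 => ?_) fun s h1 => ?_⟩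
    · refine Real.log_le_log (by positivity) ?_
      rw [div_le_iff₀ hmpos] at h
      rw [div_le_div_iff₀ h0 hpi]
      linarith
    · refine Real.log_lt_log (by positivity) ?_
      rw [lt_div_iff₀ hmpos] at h
      rw [div_lt_div_iff₀ hpi h0]
      linarith
    · have h := hneg s h1 h2
      rwa [e, e'] at h
    · have h := hpos' s h1
      rwa [e, e'] at h
  have hα : 0.894704 ≤ π / m ∧ π / m < 0.894705 := by
    constructor
    · rw [le_div_iff₀ hmpos]; linarith
    · rw [div_lt_iff₀ hmpos]; linarith
  refine ⟨π / m, hα, ⟨?_, ?_⟩, fun a ha => ?_, fun a ha => ?_, fun α hα' => ?_, fun α hα' => ?_⟩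
  · rw [one_div_div, le_div_iff₀ hpi]; norm_num at *; linarith
  · rw [one_div_div, div_le_iff₀ hpi]; norm_num at *; linarith
  · have ha0 : 0 < a := by linarith [ha.1]
    rw [← hthr a ha, partialYY_latticeTheta ha0, partialYY_latticeM ha0]
    have hb : π * a ≠ 0 := by positivity
    constructor
    · intro h
      have : π * a * (2 * thresholdNum a - π * a * thresholdDen a) = 0 := by linarith
      have := (mul_eq_zero.1 this).resolve_left hb
      linarith
    · intro h
      linear_combination (-(π * a)) * h
  · have ha0 : 0 < a := by linarith [ha.1]
    have hd := (thresholdDen_neg ha.1 ha.2).ne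
    refine ⟨hd, ?_⟩
    rw [← hthr a ha, div_mul_div_comm, div_eq_one_iff_eq (mul_ne_zero (by positivity) hd)]
  · have h0 : 0 < α := lt_of_lt_of_le (by positivity) hα'.1
    obtain ⟨s₀, -, hz, -, h⟩ := hmin α h0 hα'.2
    rw [hz hα'.1] at h
    simpa using h
  · have h1 : α ≤ 1 := by
      have := hα'.2.trans hα.2
      norm_num at this; linarith
    obtain ⟨s₀, -, -, hp, h⟩ := hmin α hα'.1 h1
    exact ⟨exp s₀, by simpa using hp hα'.2, h⟩
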